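/- Let $d\ge 2$ and let $x_1,\dots,x_N\in\mathbb R^d$ be distinct nodes in general position: no point of $\mathbb R^d$ has more than $d+1$ nearest nodes. Let $C_i=\{y: |y-x_i|\le|y-x_k|\ \forall k\}$ be the Voronoi cells. A vertex is a pair $(\sigma,r)$, where $\sigma$ is the set of indices of all nearest nodes of the point $r$ and consists of $d+1$ affinely independent nodes. Let $\mathcal M=(X,\mathcal V,E,\mathcal B^\infty)$ be the complete Voronoi diagram: $\mathcal V$ lists all vertices $(\sigma,r)$, in any order; $E$ is the set of all edges (the $d$-element subsets of the sets $\sigma$); $\mathcal B^\infty$ is the set of all unbounded edges (given by $\sigma$ and a unit direction). Let $f:\mathbb R^d\to\mathbb R$. **Minors.** $\mathtt{UpdateMinors}(\mathbb A,\upsilon,k)$ sets the column $\upsilon_k=\upsilon$ of a $d\times d$ matrix and computes, for every set $\tau$ of $k-1$ rows, the minor $m_k(\tau)$ formed by the columns $k,\dots,d$ and the rows outside $\tau$: $m_d(\tau)=(\upsilon_d)_j$ for the one $j\notin\tau$, and $$m_k(\tau)=\sum_{j\notin\tau}(-1)^{\#\{l\notin\tau:\ l<j\}}\,(\upsilon_k)_j\;m_{k+1}(\tau\cup\{j\})\qquad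 (k<d).$$ At $k=1$ it returns the determinant $m_1(\emptyset)$. **Recursion.** For a cell $i$, $n\ge1$, a list $\tilde{\mathcal V}$ of vertices (of an $n$-dimensional face), a set $\mathcal N_0$ of indices and stored minors $\mathbb A$, define $I_n(\tilde{\mathcal V},\mathcal N_0,\mathbb A)=(V,F)$ as follows. For $n=1$: take the first two vertices $r,\tilde r$ of the list, call $\mathtt{UpdateMinors}$ with $r-x_i$ at $k=2$ and then with $\tilde r-x_i$ at $k=1$; $V$ is the absolute value of the resulting determinant and $F=\frac12(f(r)+f(\tilde r))V$. (If the list has fewer than two elements, $V=F=0$.) For $n\ge2$: let $r_m$ be the arithmetic mean of the points in $\tilde{\mathcal V}$, call $\mathtt{UpdateMinors}(\mathbb A,r_m-x_i,n+1)$, let $\tilde{\mathcal V}^{(j)}$ be the sublist of vertices having $j$ among their generators, and $$V=\sum_{j\in\mathcal N_0}V_j,\qquad F=\frac{n}{n+1}\sum_{j\in\mathcal N_0}F_j+\frac1{n+1}f(r_m)V,\qquad (V_j,F_j)=I_{n-1}(\tilde{\mathcal V}^{(j)},\mathcal N_0\setminus\{j\},\mathbb A).$$ **IntegrateCell$(i,\mathcal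 M,f)$**, run for $i=1,\dots,N$ in this order. Let $\mathcal N^{(i)}$ be the set of all $j\ne i$ that share a vertex with $i$, and $\mathcal V^{(ij)}$ the list of the vertices with both $i$ and $j$ among their generators. For $j\in\mathcal N^{(i)}$ with $j>i$ let $(V_j,F_j)=\frac1{d!}I_{d-1}(\mathcal V^{(ij)},\mathcal N^{(i)}\setminus\{j\},0)$, let $h_j$ be the distance of $x_i$ from the affine span of the points of $\mathcal V^{(ij)}$, and set $A^{(i)}(j)=V_j\frac d{h_j}$, $F^{(i)}(j)=F_j\frac d{h_j}$. For $j\in\mathcal N^{(i)}$ with $j<i$ let $h_j$ be the distance of $x_i$ from the mid-plane of $x_i$ and $x_j$, set $A^{(i)}(j)=A^{(j)}(i)$, $F^{(i)}(j)=F^{(j)}(i)$ (already computed), and $V_j=\frac{h_j}dA^{(j)}(i)$, $F_j=\frac{h_j}dF^{(j)}(i)$. Return $A^{(i)}$, $F^{(i)}$ and $$V^{(i)}=\sum_{j\in\mathcal N^{(i)}}V_j,\qquad \tilde F^{(i)}=\frac d{d+1}\sum_{j\in\mathcal N^{(i)}}F_j+\frac1{d+1}f(x_i)V^{(i)} .$$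 **Interpolant.** For a nonempty set $\eta$ of at most $d$ indices, let the simplices of $\eta$ be: if $|\eta|=d$, the segments between two different vertices whose generators include $\eta$; if $|\eta|<d$, all $\mathrm{conv}(\{r_m(\eta)\}\cup S)$, where $r_m(\eta)$ is the arithmetic mean of the vertices whose generators include $\eta$, and $S$ is a simplex of $\eta\cup\{j\}$ for some $j\notin\eta$. A function $F:\mathbb R^d\to\mathbb R$ is called a linear interpolant of $f$ if, for all $i\ne j$, it is affine on each simplex $S$ of $\{i,j\}$ whenever $C_i\cap C_j$ is bounded, and on each $\mathrm{conv}(\{x_i\}\cup S)$ whenever $C_i$ is bounded, and coincides with $f$ at the corners of these simplices (vertices, midpoints $r_m$, cell centres). **Claim.** 1. For every bounded cell $C_i$, its $d$-dimensional volume is $|C_i|=V^{(i)}$. 2. For all $i\neq j$ such that $C_i\cap C_j$ is nonempty and bounded, the $(d-1)$-dimensional area of this interface is $|C_i\cap C_j|=A^{(i)}(j)$. 3. A linear interpolant $F$ of $f$ exists, and every linear interpolant $F$ is integrable with $\int_{C_i}F\,dx=\tilde F^{(i)}$ for every bounded cell $C_i$, and integrable with respect to the area with $\int_{C_i\cap C_j}F\,dS=F^{(i)}(j)$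 for all $i\ne j$ such that $C_i\cap C_j$ is nonempty and bounded. -/

import Mathlib

open MeasureTheory

noncomputable section

namespace VoronoiIntegration

/-! ### Voronoi diagrams -/

/-- The ambient Euclidean space `ℝ^d`. -/
abbrev Pt (d : ℕ) : Type := EuclideanSpace ℝ (Fin d)

/-- The indices of the nearest nodes of `y` (all of them at one common distance from `y`). -/
def nearest {d N : ℕ} (x : Fin N → Pt d) (y : Pt d) : Set (Fin N) :=
  {k | ∀ l, dist y (x k) ≤ dist y (x l)}

/-- The closed Voronoi cell `C_i`. -/
def cell {d N : ℕ} (x : Fin N → Pt d) (i : Fin N) : Set (Pt d) :=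
  {y | ∀ l, dist y (x i) ≤ dist y (x l)}

/-- The face of the diagram with generators `η` (at least): the intersection of their cells. -/
def face {d N : ℕ} (x : Fin N → Pt d) (η : Finset (Fin N)) : Set (Pt d) :=
  {y | ∀ k ∈ η, y ∈ cell x k}

/-- The nodes are distinct and no point of `ℝ^d` has more than `d + 1` nearest nodes. -/
def GeneralPosition {d N : ℕ} (x : Fin N → Pt d) : Prop :=
  Function.Injective x ∧ ∀ y : Pt d, (nearest x y).ncard ≤ d + 1

/-- `r` is the Voronoi vertex with generators `σ`: `σ` is the set of all nearest nodes of `r`, and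
consists of `d + 1` affinely independent nodes. -/
def IsVertex {d N : ℕ} (x : Fin N → Pt d) (σ : Finset (Fin N)) (r : Pt d) : Prop :=
  (σ : Set (Fin N)) = nearest x r ∧ σ.card = d + 1 ∧
    AffineIndependent ℝ (fun k : σ => x k)

/-- The mesh data structure `(X, V, E, B^∞)`.  A vertex is stored as the pair of its generators and
its coordinate, an edge as the set of its `d` generators, and an unbounded edge as the generators of
a vertex together with a direction. -/
structure Mesh (d N : ℕ) where
  nodes : Fin N → Pt d
  vertices : List (Finset (Fin N) × Pt d)
  edges : Finset (Finset (Fin N))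
  unboundedEdges : Finset (Finset (Fin N) × Pt d)

/-- The mesh stores the complete Voronoi diagram of its nodes: every vertex (exactly once, in an
arbitrary order), every edge and every unbounded edge. -/
structure Mesh.IsComplete {d N : ℕ} (M : Mesh d N) : Prop where
  nodup : M.vertices.Nodup
  mem_vertices : ∀ σ r, (σ, r) ∈ M.vertices ↔ IsVertex M.nodes σ r
  mem_edges : ∀ η, η ∈ M.edges ↔ η.card = d ∧ ∃ σ r, IsVertex M.nodes σ r ∧ η ⊆ σ
  mem_unboundedEdges : ∀ σ u, (σ, u) ∈ M.unboundedEdges ↔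
    ‖u‖ = 1 ∧ ∃ r η, IsVertex M.nodes σ r ∧ η ⊆ σ ∧ η.card = d ∧
      ∀ t : ℝ, 0 ≤ t → r + t • u ∈ face M.nodes η

/-! ### The minor recursion -/

/-- The data set `𝔸`: the vectors `υ_1, …, υ_d` (the columns of a matrix) together with the stored
minors.  `minor k τ`, for a set `τ` of `k - 1` rows, holds the minor that is left when the columns
`1, …, k - 1` and the rows in `τ` are erased; it depends on `υ_k, …, υ_d` only. -/
structure Minors (d : ℕ) where
  vec : ℕ → Pt d
  minor : ℕ → Finset (Fin d) → ℝ

/-- `𝔸` initialised with `υ_1 = … = υ_d = 0`. -/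
def Minors.init (d : ℕ) : Minors d where
  vec := fun _ => 0
  minor := fun _ _ => 0

/-- `UpdateMinors(𝔸, υ, k)`: set `υ_k = υ` and compute the minors of level `k` from those of level
`k + 1` by expansion along the column `υ_k`.  The sign of the row `j` is given by its position among
the rows that have not been erased.  For `k = d` the minors (`τ` has one row fewer than there are)
are the entries of `υ_d`. -/
def updateMinors {d : ℕ} (A : Minors d) (v : Pt d) (k : ℕ) : Minors d where
  vec := Function.update A.vec k v
  minor := Function.update A.minor k (fun τ =>
    if k = d then ∑ j ∈ τᶜ, v j
    else ∑ j ∈ τᶜ, (-1) ^ (τᶜ.filter (· < j)).card * v j * A.minor (k + 1) (insert j τ))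

/-- The value returned by `UpdateMinors(𝔸, υ, 1)`: the full determinant. -/
def Minors.det {d : ℕ} (A : Minors d) : ℝ := A.minor 1 ∅

/-! ### The integration algorithm -/

/-- The sublist `𝓥^(j)` of those stored vertices that have `j` among their generators. -/
def having {d N : ℕ} (j : Fin N) (V : List (Finset (Fin N) × Pt d)) :
    List (Finset (Fin N) × Pt d) :=
  V.filter (fun v => decide (j ∈ v.1))

/-- The midpoint `r_m` of a list of vertices. -/
def midpoint {d N : ℕ} (V : List (Finset (Fin N) × Pt d)) : Pt d :=
  (V.length : ℝ)⁻¹ • (V.map Prod.snd).sum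

/-- `IterativeVolume` at the recursion depths `2 ≤ D ≤ d`, for the cell with centre `c`.  The first
explicit argument is the dimension `n = d - D + 1` of the face whose vertices are listed in `V`; `N₀`
is the set of the neighbours that have not been used on the way down.  All points are taken relative
to `c`.  The data set `𝔸` is handed down by value, which has the effect of one shared copy, since
every call overwrites the levels it uses before they are read. -/
def iterativeVolume {d N : ℕ} (c : Pt d) (f : Pt d → ℝ) :
    ℕ → List (Finset (Fin N) × Pt d) → Finset (Fin N) → Minors d → ℝ × ℝ
  | 0, _, _, _ => (0, 0)
  | 1, V, _, A =>
    match V with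
    | v :: w :: _ =>
      let vol := |(updateMinors (updateMinors A (v.2 - c) 2) (w.2 - c) 1).det|
      (vol, (1 / 2) * (f v.2 + f w.2) * vol)
    | _ => (0, 0)
  | n + 2, V, N₀, A =>
    let m := midpoint V
    let A' := updateMinors A (m - c) (n + 3)
    let S := ∑ j ∈ N₀, iterativeVolume c f (n + 1) (having j V) (N₀.erase j) A'
    (S.1, ((n : ℝ) + 2) / ((n : ℝ) + 3) * S.2 + 1 / ((n : ℝ) + 3) * f m * S.1)

/-- The output for one cell: its volume, the integral over it, and for each other cell the area of
the interface and the integral over it. -/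
structure CellData (N : ℕ) where
  volume : ℝ
  integral : ℝ
  area : Fin N → ℝ
  areaIntegral : Fin N → ℝ

/-- The empty record. -/
def CellData.empty (N : ℕ) : CellData N where
  volume := 0
  integral := 0
  area := fun _ => 0
  areaIntegral := fun _ => 0

/-- The neighbours `𝓝^(i)` of the cell `i`, read off from the stored vertices. -/
def Mesh.neighbors {d N : ℕ} (M : Mesh d N) (i : Fin N) : Finset (Fin N) :=
  Finset.univ.filter (fun j => j ≠ i ∧ ∃ v ∈ M.vertices, i ∈ v.1 ∧ j ∈ v.1)

/-- `IntegrateCell(i, M, f)`, including the depth `D = 1` of `IterativeVolume`.  The argument `T` holds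
the records of the cells that have been processed before; an interface with a cell `j < i` is taken
over from the record of `j`. -/
def integrateCell {d N : ℕ} (i : Fin N) (M : Mesh d N) (f : Pt d → ℝ)
    (T : Fin N → CellData N) : CellData N :=
  let c := M.nodes i
  let V := having i M.vertices
  let N₀ := M.neighbors i
  let up := N₀.filter (fun j => i < j)
  let down := N₀.filter (fun j => j < i)
  let pyr : Fin N → ℝ × ℝ := fun j =>
    (1 / (d.factorial : ℝ)) •
      iterativeVolume c f (d - 1) (having j V) (N₀.erase j) (Minors.init d)
  let hUp : Fin N → ℝ := fun j =>
    Metric.infDist c (affineSpan ℝ {p : Pt d | ∃ v ∈ having j V, v.2 = p} : Set (Pt d))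
  let hDown : Fin N → ℝ := fun j =>
    Metric.infDist c (AffineSubspace.perpBisector c (M.nodes j) : Set (Pt d))
  let vol := ∑ j ∈ up, (pyr j).1 + ∑ j ∈ down, hDown j / d * (T j).area i
  let int := ∑ j ∈ up, (pyr j).2 + ∑ j ∈ down, hDown j / d * (T j).areaIntegral i
  { volume := vol
    integral := (d : ℝ) / (d + 1) * int + 1 / ((d : ℝ) + 1) * f c * vol
    area := fun j =>
      if j ∈ up then (pyr j).1 * (d / hUp j) else if j ∈ down then (T j).area i else 0
    areaIntegral := fun j =>
      if j ∈ up then (pyr j).2 * (d / hUp j) else if j ∈ down then (T j).areaIntegral i else 0 }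

/-- `IntegrateCell` run on all cells, one after the other in the order of their indices. -/
def integrateAll {d N : ℕ} (M : Mesh d N) (f : Pt d → ℝ) : Fin N → CellData N :=
  (List.finRange N).foldl (fun T i => Function.update T i (integrateCell i M f T))
    (fun _ => CellData.empty N)

/-! ### The linear interpolant -/

/-- The stored vertices of the face with generators `η`. -/
def Mesh.faceVertices {d N : ℕ} (M : Mesh d N) (η : Finset (Fin N)) :
    List (Finset (Fin N) × Pt d) :=
  M.vertices.filter (fun v => decide (η ⊆ v.1))

/-- The corner lists of the simplices into which the recursion decomposes the face with generators
`η`: an edge (`d` generators) is spanned by two of its vertices; a face of higher dimension is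
decomposed into the pyramids with apex its midpoint over the simplices of its facets. -/
inductive IsFaceSimplex {d N : ℕ} (M : Mesh d N) : Finset (Fin N) → List (Pt d) → Prop
  | edge (η : Finset (Fin N)) (v w : Finset (Fin N) × Pt d) (hη : η.card = d)
      (hv : v ∈ M.faceVertices η) (hw : w ∈ M.faceVertices η) (hvw : v ≠ w) :
      IsFaceSimplex M η [v.2, w.2]
  | cone (η : Finset (Fin N)) (j : Fin N) (L : List (Pt d)) (hη : η.card < d) (hj : j ∉ η)
      (hL : IsFaceSimplex M (insert j η) L) :
      IsFaceSimplex M η (midpoint (M.faceVertices η) :: L)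

/-- On the convex hull of the points in `L`, the function `F` is affine and takes the values of `f`
at these points. -/
def InterpolatesOn {d : ℕ} (f F : Pt d → ℝ) (L : List (Pt d)) : Prop :=
  ∃ a : Pt d →ᵃ[ℝ] ℝ, (∀ p ∈ L, a p = f p) ∧ ∀ y ∈ convexHull ℝ {p | p ∈ L}, F y = a y

/-- `F` linearly interpolates `f` between the vertices, the cell centres and the midpoints: it does so
on every simplex of the decomposition of a bounded interface and on every pyramid with apex a node
`x_i` over such a simplex in a bounded cell `C_i`. -/
structure IsLinearInterpolant {d N : ℕ} (M : Mesh d N) (f F : Pt d → ℝ) : Prop where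
  interface : ∀ i j : Fin N, i ≠ j →
    Bornology.IsBounded (cell M.nodes i ∩ cell M.nodes j) →
    ∀ L, IsFaceSimplex M {i, j} L → InterpolatesOn f F L
  cell : ∀ i j : Fin N, i ≠ j → Bornology.IsBounded (cell M.nodes i) →
    ∀ L, IsFaceSimplex M {i, j} L → InterpolatesOn f F (M.nodes i :: L)

end VoronoiIntegration

end

noncomputable section

namespace VoronoiIntegration

/-! A bounded face is a polytope, and in general position its extreme points are Voronoi vertices
(`isVertex_of_mem_extremePoints`). The mean of its vertices has exactly the generators of the face
as nearest nodes (`nearest_midpoint`), hence lies in the relative interior, and the face is the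
union of the cones from this point over its facets (`face_eq_iUnion_join`). The same holds for a
bounded cell with `x_i` as apex. Iterating down to the edges cuts the cell into simplices with
corners `x_i`, `d - 2` midpoints and two vertices. Cones over different facets overlap in null sets
(`volume_joins_facet_inter`), so integrals add up.

On one simplex an affine function integrates to `|det| / d!` times the mean of its corner values
(`setIntegral_affine_convexHull`). The determinant is the one which the minors produce by Laplace
expansion (`laplace_eq_det`), and the weights `n/(n+1)`, `1/(n+1)` of the recursion accumulate to
the mean over all `d + 1` corners. The invariant that carries the induction is
`setIntegral_joins_face_eq`; volumes are the case `f = 1`.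

Areas come from pyramids: a function homogeneous of degree `p` about the apex has over a pyramid of
height `h` the integral `h / (d + p)` times its integral over the base (`setIntegral_join_eq`).
Degree `0` gives the area, degree `1` the integral of the interpolant over the interface. Both sides
of an interface yield the same area data, so copying the record of the cell treated earlier is
correct.

A linear interpolant is built from the edges upwards, extending affinely along the rays from each
midpoint and at last from each node (`exists_cone_extension`). This is consistent because the set of
nearest nodes tells in which open face a point lies. -/

/-! ### Laplace expansion along successive columns -/

/-- The minor of the matrix with the columns `l` that is left when the rows in `τ` are erased,
computed by successive expansion along the first column. -/
def laplace {d : ℕ} : List (Pt d) → Finset (Fin d) → ℝ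
  | [], _ => 1
  | v :: l, τ => ∑ j ∈ τᶜ, (-1) ^ (τᶜ.filter (· < j)).card * v j * laplace l (insert j τ)

/-- Erasing a further row turns the increasing enumeration of the surviving rows into the one that
skips its index, so each summand is a cofactor of the expansion along column `0`. -/
theorem laplace_eq_det {d : ℕ} (l : List (Pt d)) (τ : Finset (Fin d)) (h : τᶜ.card = l.length) :
    laplace l τ =
      (Matrix.of fun a b : Fin l.length => (l.get b) (τᶜ.orderEmbOfFin h a)).det := by
  induction l generalizing τ with
  | nil => simp [laplace]
  | cons v l ih =>
    rw [laplace, Matrix.det_succ_column_zero (n := l.length)]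
    rw [← Finset.sum_coe_sort τᶜ (fun j => (-1) ^ (τᶜ.filter (· < j)).card * v j *
      laplace l (insert j τ)), ← Equiv.sum_comp (τᶜ.orderIsoOfFin h).toEquiv]
    refine Finset.sum_congr rfl fun i _ => ?_
    set e := τᶜ.orderEmbOfFin h with he
    have hei : ((τᶜ.orderIsoOfFin h).toEquiv i).1 = e i := rfl
    have hmem : ∀ a, e a ∈ τᶜ := fun a => Finset.orderEmbOfFin_mem _ h a
    rw [hei]
    have hcompl : (insert (e i) τ)ᶜ = τᶜ.erase (e i) := by
      ext a; simp
    have hcard : ((insert (e i) τ)ᶜ).card = l.length := by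
      rw [hcompl, Finset.card_erase_of_mem (hmem i), h]; simp
    -- The position of a row among the surviving ones is its index in the submatrix, which is the
    -- exponent of the Laplace sign.
    have hfilter : (τᶜ.filter (· < e i)).card = i := by
      have : τᶜ.filter (· < e i) = (Finset.univ.filter (· < i)).map e.toEmbedding := by
        ext a
        simp only [Finset.mem_filter, Finset.mem_map, Finset.mem_univ, true_and]
        constructor
        · rintro ⟨ha, hlt⟩
          have : a ∈ Set.range e := by rw [Finset.range_orderEmbOfFin]; exact ha
          obtain ⟨b, rfl⟩ := this
          exact ⟨b, e.lt_iff_lt.1 hlt, rfl⟩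
        · rintro ⟨b, hb, rfl⟩
          exact ⟨hmem b, e.lt_iff_lt.2 hb⟩
      rw [this, Finset.card_map]
      simp [Finset.filter_gt_eq_Iio]
    rw [hfilter, ih _ hcard]
    have hsub : (fun a : Fin l.length => e ((i : Fin (l.length + 1)).succAbove a)) =
        (insert (e i) τ)ᶜ.orderEmbOfFin hcard := by
      refine Finset.orderEmbOfFin_unique hcard (fun a => ?_) ?_
      · rw [hcompl, Finset.mem_erase]
        exact ⟨fun h' => Fin.succAbove_ne _ _ (e.injective h'), hmem _⟩
      · exact e.strictMono.comp (Fin.strictMono_succAbove _)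
    have hM : (Matrix.of fun a b : Fin l.length => (l.get b)
        ((insert (e i) τ)ᶜ.orderEmbOfFin hcard a)) =
        (Matrix.of fun a b => ((v :: l).get b) (e a)).submatrix
          (Fin.succAbove (n := l.length) i) Fin.succ := by
      ext a b
      simp only [Matrix.of_apply, Matrix.submatrix_apply]
      rw [← hsub]
      rfl
    rw [hM]
    rfl

/-- The stored minors of level `k` are those of the matrix with the columns `l`. -/
def Minors.Stores {d : ℕ} (A : Minors d) (k : ℕ) (l : List (Pt d)) : Prop :=
  ∀ τ : Finset (Fin d), τ.card + 1 = k → k ≤ d → A.minor k τ = laplace l τ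

theorem Minors.Stores.update {d : ℕ} {A : Minors d} {k : ℕ} {l : List (Pt d)}
    (h : A.Stores (k + 1) l) (hl : l.length + k = d) (v : Pt d) :
    (updateMinors A v k).Stores k (v :: l) := by
  intro τ hτ hk
  simp only [updateMinors, Function.update_self, laplace]
  split_ifs with hkd
  -- At level `d` one row survives: sign and empty minor are both `1`, which is why `updateMinors`
  -- reads no level `d + 1`.
  · obtain rfl : l = [] := List.length_eq_zero_iff.1 (by omega)
    have hc : τᶜ.card = 1 := by
      rw [Finset.card_compl, Fintype.card_fin]; omega
    obtain ⟨j, hj⟩ := Finset.card_eq_one.1 hc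
    simp [hj, laplace, Finset.filter_singleton]
  · refine Finset.sum_congr rfl fun j hj => ?_
    rw [h (insert j τ) ?_ (by omega)]
    rw [Finset.card_insert_of_notMem (by simpa using hj), hτ]

theorem Minors.Stores.det_eq {d : ℕ} {A : Minors d} {l : List (Pt d)} (hd : 1 ≤ d)
    (h : A.Stores 1 l) (hl : l.length = d) (w : Fin d → Pt d) (hw : l = List.ofFn w) :
    A.det = (Matrix.of fun a b : Fin d => w b a).det := by
  rw [Minors.det, h ∅ (by simp) hd, laplace_eq_det l ∅ (by simp [hl])]
  subst hw
  rw [← Matrix.det_reindex_self (finCongr (List.length_ofFn (f := w)))]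
  congr 1
  ext a b
  simp only [Matrix.reindex_apply, Matrix.submatrix_apply, Matrix.of_apply, List.get_ofFn]
  have : (fun a : Fin (List.ofFn w).length => Fin.cast (List.length_ofFn (f := w)) a) =
      (∅ᶜ : Finset (Fin d)).orderEmbOfFin (by simp) := by
    refine Finset.orderEmbOfFin_unique _ (fun a => by simp) fun a b hab => by simpa using hab
  rw [← this]
  simp

/-! ### Integrals of affine functions over simplices -/

/-- The corner simplex `{x ≥ 0, ∑ x ≤ 1}`. -/
def cornerSimplex (n : ℕ) : Set (Fin n → ℝ) := {x | (∀ k, 0 ≤ x k) ∧ ∑ k, x k ≤ 1}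

theorem isCompact_cornerSimplex (n : ℕ) : IsCompact (cornerSimplex n) := by
  refine (isCompact_Icc (a := (0 : Fin n → ℝ)) (b := 1)).of_isClosed_subset ?_ ?_
  · have : cornerSimplex n = (⋂ k, {x | 0 ≤ x k}) ∩ {x | ∑ k, x k ≤ 1} := by
      ext x; simp [cornerSimplex]
    rw [this]
    exact (isClosed_iInter fun k => isClosed_le continuous_const (continuous_apply k)).inter
      (isClosed_le (by fun_prop) continuous_const)
  · rintro x ⟨h0, h1⟩
    exact ⟨h0, fun k => (Finset.single_le_sum (fun i _ => h0 i) (Finset.mem_univ k)).trans h1⟩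

theorem insertNth_mem_cornerSimplex {n : ℕ} (k : Fin (n + 1)) (t : ℝ) (x : Fin n → ℝ) :
    k.insertNth (α := fun _ => ℝ) t x ∈ cornerSimplex (n + 1) ↔
      0 ≤ t ∧ (∀ i, 0 ≤ x i) ∧ ∑ i, x i ≤ 1 - t := by
  simp only [cornerSimplex, Set.mem_ofPred_eq, Fin.forall_iff_succAbove k, Fin.insertNth_apply_same,
    Fin.insertNth_apply_succAbove, Fin.sum_univ_succAbove _ k, and_assoc]
  constructor
  · rintro ⟨h1, h2, h3⟩; exact ⟨h1, h2, by linarith⟩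
  · rintro ⟨h1, h2, h3⟩; exact ⟨h1, h2, by linarith⟩

/-- Fubini in the coordinate `k`: the slice at height `t` is a copy of the lower corner simplex
scaled by `1 - t`. -/
theorem setIntegral_cornerSimplex_succ {n : ℕ} (k : Fin (n + 1)) (φ : ℝ → ℝ) (hφ : Continuous φ) :
    ∫ x in cornerSimplex (n + 1), φ (x k) =
      (∫ t in (0 : ℝ)..1, φ t * (1 - t) ^ n) * volume.real (cornerSimplex n) := by
  have hmp := (volume_preserving_piFinSuccAbove (fun _ : Fin (n + 1) => ℝ) k).symm
  have hint : IntegrableOn (fun x : Fin (n + 1) → ℝ => φ (x k)) (cornerSimplex (n + 1)) :=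
    (hφ.comp (continuous_apply k)).continuousOn.integrableOn_compact (isCompact_cornerSimplex _)
  have hms := (isCompact_cornerSimplex (n + 1)).measurableSet
  rw [← integral_indicator hms, ← hmp.integral_comp' (g := (cornerSimplex (n + 1)).indicator _)]
  have hint2 := (hmp.integrable_comp_emb (MeasurableEquiv.measurableEmbedding _)).2
    (hint.integrable_indicator hms)
  rw [Measure.volume_eq_prod] at hint2 ⊢
  simp only [Function.comp_def] at hint2
  rw [integral_prod _ hint2, intervalIntegral.integral_of_le zero_le_one,
    ← integral_Icc_eq_integral_Ioc, ← integral_mul_const,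
    ← integral_indicator (s := Set.Icc (0 : ℝ) 1) measurableSet_Icc]
  refine integral_congr_ae (Filter.Eventually.of_forall fun t => ?_)
  have key : ∀ x : Fin n → ℝ, (cornerSimplex (n + 1)).indicator (fun x => φ (x k))
      ((MeasurableEquiv.piFinSuccAbove (fun _ : Fin (n + 1) => ℝ) k).symm (t, x)) =
      ({x | 0 ≤ t ∧ (∀ i, 0 ≤ x i) ∧ ∑ i, x i ≤ 1 - t} : Set (Fin n → ℝ)).indicator
        (fun _ => φ t) x := by
    intro x
    have hx : (MeasurableEquiv.piFinSuccAbove (fun _ : Fin (n + 1) => ℝ) k).symm (t, x) =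
      k.insertNth (α := fun _ => ℝ) t x := rfl
    rw [hx]
    have hiff : k.insertNth (α := fun _ => ℝ) t x ∈ cornerSimplex (n + 1) ↔
        x ∈ ({x | 0 ≤ t ∧ (∀ i, 0 ≤ x i) ∧ ∑ i, x i ≤ 1 - t} : Set (Fin n → ℝ)) :=
      insertNth_mem_cornerSimplex k t x
    by_cases h : k.insertNth (α := fun _ => ℝ) t x ∈ cornerSimplex (n + 1)
    · rw [Set.indicator_of_mem h, Set.indicator_of_mem (hiff.1 h), Fin.insertNth_apply_same]
    · rw [Set.indicator_of_notMem h, Set.indicator_of_notMem fun h' => h (hiff.2 h')]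
  simp_rw [key]
  by_cases ht : t ∈ Set.Icc (0 : ℝ) 1
  · rw [Set.indicator_of_mem ht]
    have hset : ({x | 0 ≤ t ∧ (∀ i, 0 ≤ x i) ∧ ∑ i, x i ≤ 1 - t} : Set (Fin n → ℝ)) =
        {x | (∀ i, 0 ≤ x i) ∧ ∑ i, x i ≤ 1 - t} := by
      ext x; simp [ht.1]
    have hcl : MeasurableSet {x : Fin n → ℝ | (∀ i, 0 ≤ x i) ∧ ∑ i, x i ≤ 1 - t} := by
      have : {x : Fin n → ℝ | (∀ i, 0 ≤ x i) ∧ ∑ i, x i ≤ 1 - t} =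
          (⋂ k, {x | 0 ≤ x k}) ∩ {x | ∑ k, x k ≤ 1 - t} := by
        ext x; simp
      rw [this]
      exact ((isClosed_iInter fun k => isClosed_le continuous_const (continuous_apply k)).inter
        (isClosed_le (by fun_prop) continuous_const)).measurableSet
    rw [hset, integral_indicator hcl, setIntegral_const, smul_eq_mul]
    have hvol : volume.real {x : Fin n → ℝ | (∀ i, 0 ≤ x i) ∧ ∑ i, x i ≤ 1 - t} =
        (1 - t) ^ n * volume.real (cornerSimplex n) := by
      -- Scaling needs `1 - t ≠ 0`. At `t = 1` the slice is one point, of volume `1` in dimension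
      -- `0` and `0` otherwise, in agreement with `0 ^ n`.
      rcases eq_or_lt_of_le ht.2 with rfl | hlt
      · rcases Nat.eq_zero_or_pos n with rfl | hn
        · simp [cornerSimplex]
        · have : {x : Fin n → ℝ | (∀ i, 0 ≤ x i) ∧ ∑ i, x i ≤ 1 - 1} ⊆ {0} := by
            rintro x ⟨h0, h1⟩
            ext i
            have := Finset.single_le_sum (fun i _ => h0 i) (Finset.mem_univ i)
            simp only [Pi.zero_apply]
            have := h0 i
            linarith
          have hne : Nonempty (Fin n) := ⟨⟨0, hn⟩⟩
          rw [measureReal_def, measure_mono_null this (measure_singleton 0)]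
          simp [hn.ne']
      · have h1t : 0 < 1 - t := by linarith
        have : {x : Fin n → ℝ | (∀ i, 0 ≤ x i) ∧ ∑ i, x i ≤ 1 - t} =
            (fun x => (1 - t) • x) '' cornerSimplex n := by
          ext x
          constructor
          · rintro ⟨h0, h1⟩
            refine ⟨(1 - t)⁻¹ • x, ⟨fun i => ?_, ?_⟩, ?_⟩
            · have := h0 i
              simp only [Pi.smul_apply, smul_eq_mul]; positivity
            · simp only [Pi.smul_apply, smul_eq_mul, ← Finset.mul_sum]
              rw [inv_mul_le_iff₀ h1t]; linarith
            · simp only [smul_smul, mul_inv_cancel₀ h1t.ne', one_smul]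
          · rintro ⟨y, ⟨h0, h1⟩, rfl⟩
            refine ⟨fun i => ?_, ?_⟩
            · have := h0 i
              simp only [Pi.smul_apply, smul_eq_mul]; positivity
            · simp only [Pi.smul_apply, smul_eq_mul, ← Finset.mul_sum]
              nlinarith
        rw [this, Set.image_smul, measureReal_def, Measure.addHaar_smul, ENNReal.toReal_mul,
          ENNReal.toReal_ofReal (abs_nonneg _), abs_of_nonneg (by positivity)]
        simp [measureReal_def]
    rw [hvol]; ring
  · rw [Set.indicator_of_notMem ht]
    refine integral_eq_zero_of_ae (Filter.Eventually.of_forall fun x => ?_)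
    refine Set.indicator_of_notMem (fun h => ht ⟨h.1, ?_⟩) _
    have := Finset.sum_nonneg fun i (_ : i ∈ Finset.univ) => h.2.1 i
    linarith [h.2.2]

theorem integral_one_sub_pow (n : ℕ) : ∫ t in (0 : ℝ)..1, (1 - t) ^ n = 1 / (n + 1) := by
  have := intervalIntegral.integral_comp_sub_left (fun t : ℝ => t ^ n) (a := 0) (b := 1) 1
  rw [this]; simp [integral_pow]

theorem integral_mul_one_sub_pow (n : ℕ) :
    ∫ t in (0 : ℝ)..1, t * (1 - t) ^ n = 1 / ((n + 1) * (n + 2)) := by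
  have := intervalIntegral.integral_comp_sub_left (fun t : ℝ => (1 - t) * t ^ n)
    (a := 0) (b := 1) 1
  simp only [sub_sub_cancel] at this
  rw [this]
  have h : ∀ t : ℝ, (1 - t) * t ^ n = t ^ n - t ^ (n + 1) := fun t => by ring
  simp_rw [h]
  rw [intervalIntegral.integral_sub (by simp) (by simp)]
  simp only [integral_pow, sub_self, sub_zero, one_pow]
  push_cast
  rw [zero_pow (by omega), zero_pow (by omega)]
  field_simp
  ring

theorem volume_cornerSimplex (n : ℕ) : volume.real (cornerSimplex n) = 1 / n.factorial := by
  induction n with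
  | zero =>
    have : cornerSimplex 0 = Set.univ := by ext x; simp [cornerSimplex]
    rw [this]; simp [measureReal_def, Measure.volume_pi_eq_dirac (0 : Fin 0 → ℝ)]
  | succ n ih =>
    have := setIntegral_cornerSimplex_succ (0 : Fin (n + 1)) (fun _ => 1) continuous_const
    simp only [setIntegral_const, smul_eq_mul, mul_one, one_mul, integral_one_sub_pow, ih] at this
    rw [this, Nat.factorial_succ]; push_cast; field_simp

theorem setIntegral_coord_cornerSimplex {n : ℕ} (k : Fin n) :
    ∫ x in cornerSimplex n, x k = 1 / (n + 1).factorial := by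
  obtain _ | n := n
  · exact k.elim0
  have := setIntegral_cornerSimplex_succ k (fun t => t) continuous_id
  simp only [integral_mul_one_sub_pow, volume_cornerSimplex] at this
  rw [this, Nat.factorial_succ, Nat.factorial_succ]; push_cast; field_simp; ring

/-- Barycentric coordinates with the weight of `v 0` eliminated; the corners need not be
independent. -/
theorem convexHull_range_eq_image_cornerSimplex {d : ℕ} {E : Type*} [AddCommGroup E] [Module ℝ E]
    (v : Fin (d + 1) → E) :
    convexHull ℝ (Set.range v) =
      (fun x : Fin d → ℝ => v 0 + ∑ k, x k • (v k.succ - v 0)) '' cornerSimplex d := by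
  have h1 : Set.range v = Fintype.linearCombination ℝ v ''
      (Set.range fun i : Fin (d + 1) => Pi.single i (1 : ℝ)) := by
    rw [← Set.range_comp]
    congr 1
    ext i
    simp [Fintype.linearCombination_apply, Pi.single_apply]
  rw [h1, ← LinearMap.image_convexHull, convexHull_rangle_single_eq_stdSimplex]
  have hval : ∀ w : Fin (d + 1) → ℝ, ∑ i, w i = 1 → ∑ i, w i • v i =
      v 0 + ∑ k : Fin d, w k.succ • (v k.succ - v 0) := by
    intro w hw
    rw [Fin.sum_univ_succ] at hw ⊢
    simp only [smul_sub, Finset.sum_sub_distrib, ← Finset.sum_smul]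
    rw [show w 0 = 1 - ∑ i : Fin d, w i.succ by linarith]
    module
  ext y
  constructor
  · rintro ⟨w, ⟨hw0, hw1⟩, rfl⟩
    refine ⟨fun k => w k.succ, ⟨fun k => hw0 _, ?_⟩, ?_⟩
    · rw [Fin.sum_univ_succ] at hw1
      have := hw0 0
      linarith
    · rw [Fintype.linearCombination_apply, hval w hw1]
  · rintro ⟨x, ⟨hx0, hx1⟩, rfl⟩
    have hsum : ∑ i, (Fin.cons (1 - ∑ k, x k) x : Fin (d + 1) → ℝ) i = 1 := by
      simp [Fin.sum_univ_succ]
    refine ⟨Fin.cons (1 - ∑ k, x k) x, ⟨fun i => ?_, hsum⟩, ?_⟩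
    · refine Fin.cases ?_ (fun k => ?_) i
      · simpa using hx1
      · simpa using hx0 k
    · rw [Fintype.linearCombination_apply, hval _ hsum]
      simp

theorem setIntegral_affine_cornerSimplex {d : ℕ} (b : ℝ) (w : Fin d → ℝ) :
    ∫ x in cornerSimplex d, (b + ∑ k, x k * (w k - b)) =
      1 / d.factorial * ((b + ∑ k, w k) / (d + 1)) := by
  have hc := isCompact_cornerSimplex d
  rw [integral_add (by
      exact (continuous_const.continuousOn.integrableOn_compact hc)) (by
      exact (Continuous.continuousOn (by fun_prop)).integrableOn_compact hc),
    integral_finsetSum _ (fun k _ => by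
      exact (Continuous.continuousOn (by fun_prop)).integrableOn_compact hc)]
  simp only [integral_mul_const, setIntegral_coord_cornerSimplex, setIntegral_const,
    volume_cornerSimplex, smul_eq_mul, ← Finset.mul_sum, Finset.sum_sub_distrib, Finset.sum_const,
    Finset.card_univ, Fintype.card_fin, nsmul_eq_mul]
  rw [Nat.factorial_succ]; push_cast; field_simp; ring

theorem setIntegral_affine_convexHull {d : ℕ} (v : Fin (d + 1) → Pt d) (a : Pt d →ᵃ[ℝ] ℝ) :
    ∫ y in convexHull ℝ (Set.range v), a y =
      |(Matrix.of fun r k : Fin d => (v k.succ - v 0) r).det| / d.factorial *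
        ((∑ k, a (v k)) / (d + 1)) := by
  set A : Matrix (Fin d) (Fin d) ℝ := Matrix.of fun r k : Fin d => (v k.succ - v 0) r with hA
  set Ψ : (Fin d → ℝ) → (Fin d → ℝ) := fun x => (v 0).ofLp + Matrix.toLin' A x with hΨ
  have hΨv : ∀ x, WithLp.toLp 2 (Ψ x) = v 0 + ∑ k, x k • (v k.succ - v 0) := by
    intro x
    ext r
    simp [hΨ, hA, Matrix.mulVec, dotProduct, mul_comm]
  have himg : convexHull ℝ (Set.range v) =
      MeasurableEquiv.toLp 2 (Fin d → ℝ) '' (Ψ '' cornerSimplex d) := by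
    rw [convexHull_range_eq_image_cornerSimplex, Set.image_image]
    exact Set.image_congr fun x _ => (hΨv x).symm
  have hms := (isCompact_cornerSimplex d).measurableSet
  have hderiv : ∀ x ∈ cornerSimplex d,
      HasFDerivWithinAt Ψ (LinearMap.toContinuousLinearMap (Matrix.toLin' A)) (cornerSimplex d) x :=
    fun x _ => ((LinearMap.toContinuousLinearMap (Matrix.toLin' A)).hasFDerivAt.const_add
      _).hasFDerivWithinAt
  have hdet : (LinearMap.toContinuousLinearMap (Matrix.toLin' A)).det = A.det := by
    simp [ContinuousLinearMap.det]
  have hmp : MeasurePreserving (MeasurableEquiv.toLp 2 (Fin d → ℝ)) :=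
    PiLp.volume_preserving_toLp (Fin d)
  rw [himg, hmp.setIntegral_image_emb (MeasurableEquiv.measurableEmbedding _)]
  -- Degenerate simplices are admitted: both sides vanish, so nondegeneracy never has to be checked
  -- in the recursion.
  by_cases h0 : A.det = 0
  · rw [h0, Measure.restrict_eq_zero.2
      (addHaar_image_eq_zero_of_det_fderivWithin_eq_zero volume hderiv
        fun x _ => by rw [hdet, h0])]
    simp
  · have hinj : Set.InjOn Ψ (cornerSimplex d) := by
      refine Function.Injective.injOn fun x y hxy => ?_
      have : Matrix.toLin' A x = Matrix.toLin' A y := add_left_cancel hxy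
      exact Matrix.mulVec_injective_of_isUnit
        ((Matrix.isUnit_iff_isUnit_det A).2 (isUnit_iff_ne_zero.2 h0)) (by simpa using this)
    rw [integral_image_eq_integral_abs_det_fderiv_smul volume hms hderiv hinj]
    simp only [hdet, smul_eq_mul, MeasurableEquiv.coe_toLp, hΨv]
    rw [integral_const_mul]
    have hval : ∀ x : Fin d → ℝ, a (v 0 + ∑ k, x k • (v k.succ - v 0)) =
        a (v 0) + ∑ k, x k * (a (v k.succ) - a (v 0)) := by
      intro x
      have hl : ∀ p q, a (p + q) = a p + a.linear q := fun p q => by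
        rw [add_comm, ← vadd_eq_add, a.map_vadd, vadd_eq_add, add_comm]
      have hs : ∀ p q, a.linear (p - q) = a p - a q := fun p q => by
        rw [← vsub_eq_sub, a.linearMap_vsub, vsub_eq_sub]
      rw [hl, map_sum]
      simp [hs, map_smul]
    simp_rw [hval]
    rw [setIntegral_affine_cornerSimplex, Fin.sum_univ_succ]
    ring

/-! ### Cones -/

/-- The union of the segments from `p` to the points of `K`. -/
def join {d : ℕ} (p : Pt d) (K : Set (Pt d)) : Set (Pt d) :=
  {y | ∃ t ∈ Set.Icc (0 : ℝ) 1, ∃ z ∈ K, AffineMap.lineMap p z t = y}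

theorem lineMap_right_injective {d : ℕ} (c : Pt d) {t : ℝ} (ht : t ≠ 0) :
    Function.Injective fun z : Pt d => AffineMap.lineMap c z t := by
  intro z w h
  simp only [AffineMap.lineMap_apply_module'] at h
  simpa using smul_right_injective _ ht (add_right_cancel h)

/-- The parametrisation of the hyperplane at signed distance `h` from `c`, orthogonal to `e`. -/
def slice {d : ℕ} (c e : Pt d) (h : ℝ) (u : (ℝ ∙ e)ᗮ) : Pt d := h • e + u + c

theorem isometry_slice {d : ℕ} (c e : Pt d) (h : ℝ) : Isometry (slice c e h) := by
  refine Isometry.of_dist_eq fun u v => ?_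
  simp [slice, dist_eq_norm]

theorem inner_slice {d : ℕ} {c e : Pt d} (he : ‖e‖ = 1) (h : ℝ) (u : (ℝ ∙ e)ᗮ) :
    inner ℝ e (slice c e h u - c) = h := by
  have : inner ℝ e (u : Pt d) = 0 :=
    Submodule.mem_orthogonal_singleton_iff_inner_right.1 u.2
  simp [slice, inner_add_right, inner_smul_right, this, he]

theorem exists_slice {d : ℕ} {c e : Pt d} (he : ‖e‖ = 1) {h : ℝ} {y : Pt d}
    (hy : inner ℝ e (y - c) = h) : ∃ u, slice c e h u = y := by
  refine ⟨⟨y - c - h • e, Submodule.mem_orthogonal_singleton_iff_inner_right.2 ?_⟩, ?_⟩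
  · simp [inner_sub_right, inner_smul_right, he] at hy ⊢
    linarith
  · simp [slice]

theorem finrank_span_orthogonal {d : ℕ} {e : Pt d} (he : ‖e‖ = 1) :
    Module.finrank ℝ (ℝ ∙ e)ᗮ = d - 1 := by
  have h1 := (ℝ ∙ e).finrank_add_finrank_orthogonal
  have h2 : Module.finrank ℝ (ℝ ∙ e) = 1 := finrank_span_singleton (by rintro rfl; simp at he)
  rw [h2, finrank_euclideanSpace, Fintype.card_fin] at h1
  omega

theorem measurableEmbedding_slice {d : ℕ} (c e : Pt d) (h : ℝ) :
    MeasurableEmbedding (slice c e h) :=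
  (isometry_slice c e h).isClosedEmbedding.measurableEmbedding

/-- `μHE` agrees with the volume on an inner product space of dimension `d - 1` and is transported
by isometries, so area integrals in a hyperplane become Lebesgue integrals over `(ℝ ∙ e)ᗮ`. -/
theorem map_slice_volume {d : ℕ} {c e : Pt d} (he : ‖e‖ = 1) (h : ℝ) :
    Measure.map (slice c e h) volume =
      (μHE[d - 1] : Measure (Pt d)).restrict (Set.range (slice c e h)) := by
  rw [← (isometry_slice c e h).map_euclideanHausdorffMeasure, ← finrank_span_orthogonal he,
    InnerProductSpace.euclideanHausdorffMeasure_eq_volume]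

theorem hausdorff_slice_ne_top {d : ℕ} {c e : Pt d} (he : ‖e‖ = 1) {h : ℝ} {S : Set (Pt d)}
    (hS : IsCompact S) (hSH : ∀ y ∈ S, inner ℝ e (y - c) = h) : μHE[d - 1] S ≠ ⊤ := by
  have hsub : S ⊆ Set.range (slice c e h) := fun y hy => exists_slice he (hSH y hy)
  have : μHE[d - 1] S = volume (slice c e h ⁻¹' S) := by
    rw [← (measurableEmbedding_slice c e h).map_apply, map_slice_volume he,
      Measure.restrict_apply hS.measurableSet, Set.inter_eq_left.2 hsub]
  rw [this]
  exact ((isometry_slice c e h).isClosedEmbedding.isCompact_preimage hS).measure_lt_top.ne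

theorem setIntegral_slice {d : ℕ} {c e : Pt d} (he : ‖e‖ = 1) {h : ℝ} {S : Set (Pt d)}
    (hS : MeasurableSet S) (hSH : ∀ y ∈ S, inner ℝ e (y - c) = h) (F : Pt d → ℝ) :
    ∫ y in S, F y ∂μHE[d - 1] = ∫ u in slice c e h ⁻¹' S, F (slice c e h u) := by
  have hsub : S ⊆ Set.range (slice c e h) := fun y hy => exists_slice he (hSH y hy)
  rw [← (measurableEmbedding_slice c e h).setIntegral_map, map_slice_volume he,
    Measure.restrict_restrict hS, Set.inter_eq_left.2 hsub]

/-- Orthogonal coordinates along `e`. -/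
def sliceEquiv {d : ℕ} (c : Pt d) {e : Pt d} (he : ‖e‖ = 1) : ℝ × (ℝ ∙ e)ᗮ ≃ᵐ Pt d :=
  ((LinearIsometryEquiv.toSpanUnitSingleton e he).toHomeomorph.toMeasurableEquiv.prodCongr
    (MeasurableEquiv.refl _)).trans ((ℝ ∙ e).measurableEquivProd c).symm

theorem sliceEquiv_apply {d : ℕ} (c : Pt d) {e : Pt d} (he : ‖e‖ = 1) (t : ℝ) (u : (ℝ ∙ e)ᗮ) :
    sliceEquiv c he (t, u) = slice c e t u := by
  have : sliceEquiv c he (t, u) = ((ℝ ∙ e).measurableEquivProd c).symm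
    (LinearIsometryEquiv.toSpanUnitSingleton e he t, u) := rfl
  rw [this, Submodule.measurableEquivProd_symm_apply]
  simp [slice]

theorem measurePreserving_sliceEquiv {d : ℕ} (c : Pt d) {e : Pt d} (he : ‖e‖ = 1) :
    MeasurePreserving (sliceEquiv c he) := by
  have h1 := ((ℝ ∙ e).measurePreserving_measurableEquivProd c).symm
  rw [InnerProductSpace.euclideanHausdorffMeasure_eq_volume] at h1
  refine MeasurePreserving.trans ?_ h1
  exact (LinearIsometryEquiv.toSpanUnitSingleton e he).measurePreserving.prod
    (MeasurePreserving.id volume)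

theorem slice_smul {d : ℕ} (c e : Pt d) {h t : ℝ} (hh : h ≠ 0) (ht : t ≠ 0) (u : (ℝ ∙ e)ᗮ) :
    slice c e t u = AffineMap.lineMap c (slice c e h ((h / t) • u)) (t / h) := by
  simp only [slice, AffineMap.lineMap_apply_module, Submodule.coe_smul]
  match_scalars <;> field_simp
  ring

/-- Fubini along the normal: the slice of the cone at height `t` is the base scaled by `t / h`,
contributing `(t / h) ^ (d - 1)`, and homogeneity of `G` contributes `(t / h) ^ p`. Integrating over
`0 < t ≤ h` gives `h / (d + p)`. -/
theorem setIntegral_join_eq {d : ℕ} (hd : 1 ≤ d) {c e : Pt d} (he : ‖e‖ = 1) {h : ℝ} (hh : 0 < h)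
    {S : Set (Pt d)} (hS : MeasurableSet S) (hSH : ∀ y ∈ S, inner ℝ e (y - c) = h)
    (p : ℕ) (F G : Pt d → ℝ) (hG : ∀ z ∈ S, ∀ t ∈ Set.Ioc (0 : ℝ) 1,
      G (AffineMap.lineMap c z t) = t ^ p * F z)
    (hJ : MeasurableSet (join c S)) (hint : IntegrableOn G (join c S)) :
    ∫ y in join c S, G y = h / (d + p) * ∫ y in S, F y ∂μHE[d - 1] := by
  have hmp := measurePreserving_sliceEquiv c he
  have hint2 := (hmp.integrable_comp_emb (MeasurableEquiv.measurableEmbedding _)).2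
    (hint.integrable_indicator hJ)
  rw [← integral_indicator hJ, ← hmp.integral_comp' (g := (join c S).indicator _)]
  rw [Measure.volume_eq_prod] at hint2 ⊢
  simp only [Function.comp_def] at hint2
  rw [integral_prod _ hint2, setIntegral_slice he hS hSH]
  have hSm : MeasurableSet (slice c e h ⁻¹' S) := (measurableEmbedding_slice c e h).measurable hS
  have hheight : ∀ z ∈ S, ∀ s : ℝ, inner ℝ e (AffineMap.lineMap c z s - c) = s * h := by
    intro z hz s
    rw [AffineMap.lineMap_apply, vsub_eq_sub, vadd_eq_add, add_sub_cancel_right, inner_smul_right,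
      hSH z hz]
  have key : ∀ t : ℝ, t ≠ 0 → ∫ u : (ℝ ∙ e)ᗮ, (join c S).indicator G (sliceEquiv c he (t, u)) =
      (Set.Ioc 0 h).indicator (fun t => (t / h) ^ (d - 1 + p) *
        ∫ u in slice c e h ⁻¹' S, F (slice c e h u)) t := by
    intro t ht0
    simp only [sliceEquiv_apply]
    by_cases ht : t ∈ Set.Ioc 0 h
    · rw [Set.indicator_of_mem ht]
      have hval : ∀ u : (ℝ ∙ e)ᗮ, (join c S).indicator G (slice c e t u) =
          (t / h) ^ p * (slice c e h ⁻¹' S).indicator (fun u => F (slice c e h u))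
            ((h / t) • u) := by
        intro u
        have hts : t / h ∈ Set.Ioc (0 : ℝ) 1 :=
          ⟨div_pos ht.1 hh, (div_le_one hh).2 ht.2⟩
        by_cases hu : slice c e h ((h / t) • u) ∈ S
        · rw [Set.indicator_of_mem (show (h / t) • u ∈ slice c e h ⁻¹' S from hu),
            slice_smul c e hh.ne' ht0, Set.indicator_of_mem, hG _ hu _ hts]
          exact ⟨_, ⟨hts.1.le, hts.2⟩, _, hu, rfl⟩
        · rw [Set.indicator_of_notMem (show (h / t) • u ∉ slice c e h ⁻¹' S from hu),
            Set.indicator_of_notMem, mul_zero]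
          rintro ⟨s, hs, z, hz, hsz⟩
          apply hu
          have h1 := hheight z hz s
          rw [hsz, inner_slice he] at h1
          obtain ⟨v, rfl⟩ := exists_slice he (hSH z hz)
          have hs0 : s = t / h := by rw [h1]; field_simp
          rw [slice_smul c e hh.ne' ht0, hs0] at hsz
          rwa [← lineMap_right_injective c hts.1.ne' hsz]
      simp_rw [hval]
      rw [integral_const_mul, Measure.integral_comp_smul, finrank_span_orthogonal he,
        integral_indicator hSm, abs_of_nonneg (by have := ht.1; positivity), smul_eq_mul,
        ← mul_assoc]
      congr 1
      rw [pow_add, ← inv_pow, inv_div]; ring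
    · rw [Set.indicator_of_notMem ht]
      refine integral_eq_zero_of_ae (Filter.Eventually.of_forall fun u => ?_)
      refine Set.indicator_of_notMem ?_ _
      rintro ⟨s, hs, z, hz, hsz⟩
      have h1 := hheight z hz s
      rw [hsz, inner_slice he] at h1
      apply ht
      refine ⟨lt_of_le_of_ne ?_ (Ne.symm ht0), ?_⟩
      · rw [h1]; exact mul_nonneg hs.1 hh.le
      · rw [h1]; nlinarith [hs.2]
  -- The height of the apex, where homogeneity says nothing about `G`, is a null set.
  have hae : ∀ᵐ t : ℝ, t ≠ 0 := by
    simp [ae_iff, measure_singleton]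
  rw [integral_congr_ae (hae.mono fun t ht => key t ht), integral_indicator measurableSet_Ioc,
    integral_mul_const, ← intervalIntegral.integral_of_le hh.le]
  congr 1
  rw [intervalIntegral.integral_comp_div (fun t => t ^ (d - 1 + p)) hh.ne', zero_div,
    div_self hh.ne', integral_pow]
  have : ((d - 1 + p : ℕ) : ℝ) + 1 = d + p := by
    rw [Nat.cast_add, Nat.cast_sub hd]; push_cast; ring
  rw [this]
  simp
  ring

/-! ### Iterated cones -/

/-- The successive cones over `K` with the apexes in `P`, the head of the list first. -/
def joins {d : ℕ} : List (Pt d) → Set (Pt d) → Set (Pt d)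
  | [], K => K
  | p :: P, K => joins P (join p K)

theorem join_iUnion {d : ℕ} {ι : Sort*} (p : Pt d) (K : ι → Set (Pt d)) :
    join p (⋃ i, K i) = ⋃ i, join p (K i) := by
  ext y
  simp only [join, Set.mem_iUnion, Set.mem_ofPred_eq]
  constructor
  · rintro ⟨t, ht, z, ⟨i, hz⟩, rfl⟩; exact ⟨i, t, ht, z, hz, rfl⟩
  · rintro ⟨i, t, ht, z, hz, rfl⟩; exact ⟨t, ht, z, ⟨i, hz⟩, rfl⟩

theorem joins_iUnion {d : ℕ} {ι : Sort*} (P : List (Pt d)) (K : ι → Set (Pt d)) :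
    joins P (⋃ i, K i) = ⋃ i, joins P (K i) := by
  induction P generalizing K with
  | nil => rfl
  | cons p P ih => rw [joins, join_iUnion, ih]; rfl

theorem join_empty {d : ℕ} (p : Pt d) : join p ∅ = ∅ := by
  ext y; simp [join]

theorem joins_empty {d : ℕ} (P : List (Pt d)) : joins P ∅ = ∅ := by
  induction P with
  | nil => rfl
  | cons p P ih => rw [joins, join_empty, ih]

theorem isCompact_join {d : ℕ} (p : Pt d) {K : Set (Pt d)} (hK : IsCompact K) :
    IsCompact (join p K) := by
  have : join p K = (fun q : ℝ × Pt d => AffineMap.lineMap p q.2 q.1) '' (Set.Icc 0 1 ×ˢ K) := by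
    ext y
    constructor
    · rintro ⟨t, ht, z, hz, rfl⟩; exact ⟨(t, z), ⟨ht, hz⟩, rfl⟩
    · rintro ⟨⟨t, z⟩, ⟨ht, hz⟩, rfl⟩; exact ⟨t, ht, z, hz, rfl⟩
  rw [this]
  refine (isCompact_Icc.prod hK).image ?_
  simp only [AffineMap.lineMap_apply_module]
  fun_prop

theorem isCompact_joins {d : ℕ} (P : List (Pt d)) {K : Set (Pt d)} (hK : IsCompact K) :
    IsCompact (joins P K) := by
  induction P generalizing K with
  | nil => exact hK
  | cons p P ih => exact ih (isCompact_join p hK)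

theorem apply_lineMap {d : ℕ} (a : Pt d →ᵃ[ℝ] ℝ) (p z : Pt d) (t : ℝ) :
    a (AffineMap.lineMap p z t) = (1 - t) * a p + t * a z := by
  rw [AffineMap.apply_lineMap, AffineMap.lineMap_apply_module]
  rfl

theorem affine_nonpos_of_mem_joins {d : ℕ} (a : Pt d →ᵃ[ℝ] ℝ) (P : List (Pt d)) {K : Set (Pt d)}
    (hP : ∀ p ∈ P, a p ≤ 0) (hK : ∀ z ∈ K, a z ≤ 0) : ∀ y ∈ joins P K, a y ≤ 0 := by
  induction P generalizing K with
  | nil => exact hK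
  | cons p P ih =>
    refine ih (fun q hq => hP q (List.mem_cons_of_mem _ hq)) ?_
    rintro _ ⟨t, ht, z, hz, rfl⟩
    rw [apply_lineMap]
    have h1 := hP p List.mem_cons_self
    have h2 := hK z hz
    nlinarith [ht.1, ht.2]

theorem join_convexHull {d : ℕ} (p : Pt d) {s : Set (Pt d)} (hs : s.Nonempty) :
    join p (convexHull ℝ s) = convexHull ℝ (insert p s) := by
  rw [convexHull_insert hs]
  ext y
  simp only [mem_convexJoin, Set.mem_singleton_iff, exists_eq_left, segment_eq_image_lineMap]
  constructor
  · rintro ⟨t, ht, z, hz, rfl⟩; exact ⟨z, hz, t, ht, rfl⟩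
  · rintro ⟨z, hz, t, ht, rfl⟩; exact ⟨t, ht, z, hz, rfl⟩

theorem joins_convexHull {d : ℕ} (P : List (Pt d)) {s : Set (Pt d)} (hs : s.Nonempty) :
    joins P (convexHull ℝ s) = convexHull ℝ ({p | p ∈ P} ∪ s) := by
  induction P generalizing s with
  | nil => simp [joins]
  | cons p P ih =>
    rw [joins, join_convexHull p hs, ih (Set.insert_nonempty _ _)]
    congr 1
    ext q
    simp only [Set.mem_union, Set.mem_ofPred_eq, Set.mem_insert_iff, List.mem_cons]
    tauto

/-- Every affine functional on `K` extends to one which vanishes at the points of `P`. -/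
def AffineExtendable {d : ℕ} (P : List (Pt d)) (K : Set (Pt d)) : Prop :=
  ∀ g : Pt d →ᵃ[ℝ] ℝ, ∃ g' : Pt d →ᵃ[ℝ] ℝ, (∀ p ∈ P, g' p = 0) ∧ ∀ z ∈ K, g' z = g z

theorem affineExtendable_nil {d : ℕ} (K : Set (Pt d)) : AffineExtendable [] K :=
  fun g => ⟨g, by simp, fun _ _ => rfl⟩

/-- Subtracting `g m • q` makes `g` vanish at the new apex and leaves it unchanged on `K'`; the old
apexes are then handled by the hypothesis on `K`. -/
theorem AffineExtendable.cons {d : ℕ} {P : List (Pt d)} {K K' : Set (Pt d)} {m : Pt d}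
    (h : AffineExtendable P K) (hm : m ∈ K) (hK' : K' ⊆ K) (q : Pt d →ᵃ[ℝ] ℝ) (hqm : q m = 1)
    (hq : ∀ z ∈ K', q z = 0) : AffineExtendable (m :: P) K' := by
  intro g
  obtain ⟨g', hP, hK⟩ := h (g - g m • q)
  refine ⟨g', ?_, fun z hz => ?_⟩
  · rintro p hp
    rcases List.mem_cons.1 hp with rfl | hp
    · rw [hK _ hm]; simp [hqm]
    · exact hP p hp
  · rw [hK z (hK' hz)]; simp [hq z hz]

theorem volume_affine_eq_zero {d : ℕ} (g : Pt d →ᵃ[ℝ] ℝ) {y : Pt d} (hy : g y ≠ 0) :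
    volume {z | g z = 0} = 0 := by
  have h := Measure.addHaar_affineSubspace volume
    ((AffineSubspace.mk' (0 : ℝ) (⊥ : Submodule ℝ ℝ)).comap g) ?_
  · convert h using 2
    ext z
    simp [AffineSubspace.mem_mk']
  · intro htop
    have : y ∈ (AffineSubspace.mk' (0 : ℝ) (⊥ : Submodule ℝ ℝ)).comap g := by
      rw [htop]; exact AffineSubspace.mem_top _ _ _
    simp [AffineSubspace.mem_comap, AffineSubspace.mem_mk'] at this
    exact hy this

/-! ### The faces of a Voronoi diagram -/

variable {d N : ℕ} {x : Fin N → Pt d}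

/-- The affine functional `y ↦ |y - x_k|² - |y - x_i|²`. -/
def gap (x : Fin N → Pt d) (i k : Fin N) : Pt d →ᵃ[ℝ] ℝ :=
  ((-2 : ℝ) • (innerSL ℝ (x k - x i)).toLinearMap).toAffineMap +
    AffineMap.const ℝ (Pt d) (‖x k‖ ^ 2 - ‖x i‖ ^ 2)

theorem gap_apply' (i k : Fin N) (y : Pt d) :
    gap x i k y = -2 * inner ℝ (x k - x i) y + (‖x k‖ ^ 2 - ‖x i‖ ^ 2) := by
  simp [gap, inner_sub_left]

theorem gap_apply (i k : Fin N) (y : Pt d) :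
    gap x i k y = dist y (x k) ^ 2 - dist y (x i) ^ 2 := by
  rw [gap_apply', dist_eq_norm, dist_eq_norm, norm_sub_sq_real, norm_sub_sq_real, inner_sub_left,
    real_inner_comm y (x k), real_inner_comm y (x i)]
  ring

theorem gap_add_smul (i k : Fin N) (y u : Pt d) (t : ℝ) :
    gap x i k (y + t • u) = gap x i k y - 2 * t * inner ℝ (x k - x i) u := by
  rw [gap_apply', gap_apply', inner_add_right, inner_smul_right]; ring

theorem continuous_gap (i k : Fin N) : Continuous (gap x i k) :=
  AffineMap.continuous_of_finiteDimensional _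

theorem mem_face_iff_subset_nearest {η : Finset (Fin N)} {y : Pt d} :
    y ∈ face x η ↔ (η : Set (Fin N)) ⊆ nearest x y := Iff.rfl

theorem mem_cell_iff {i : Fin N} {y : Pt d} : y ∈ cell x i ↔ ∀ k, 0 ≤ gap x i k y := by
  refine forall_congr' fun k => ?_
  rw [gap_apply, sub_nonneg, sq_le_sq₀ dist_nonneg dist_nonneg]

theorem mem_face_iff {η : Finset (Fin N)} {i : Fin N} (hi : i ∈ η) {y : Pt d} :
    y ∈ face x η ↔ (∀ k, 0 ≤ gap x i k y) ∧ ∀ k ∈ η, gap x i k y = 0 := by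
  constructor
  · intro h
    have h1 := mem_cell_iff.1 (h i hi)
    refine ⟨h1, fun k hk => le_antisymm ?_ (h1 k)⟩
    have := mem_cell_iff.1 (h k hk) i
    rw [gap_apply] at this ⊢
    linarith
  · rintro ⟨h1, h2⟩ k hk
    refine mem_cell_iff.2 fun l => ?_
    have h3 := h1 l
    have h4 := h2 k hk
    rw [gap_apply] at h3 h4 ⊢
    linarith

theorem mem_nearest_iff {i k : Fin N} {y : Pt d} (hi : i ∈ nearest x y) :
    k ∈ nearest x y ↔ gap x i k y = 0 := by
  have h1 := mem_cell_iff.1 (show y ∈ cell x i from hi)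
  constructor
  · intro hk
    have h2 := mem_cell_iff.1 (show y ∈ cell x k from hk) i
    have h3 := h1 k
    rw [gap_apply] at h2 h3 ⊢
    linarith
  · intro hk
    refine mem_cell_iff.2 fun l => ?_
    have h3 := h1 l
    rw [gap_apply] at h3 hk ⊢
    linarith

theorem gap_pos {i k : Fin N} {y : Pt d} (hi : i ∈ nearest x y) (hk : k ∉ nearest x y) :
    0 < gap x i k y :=
  lt_of_le_of_ne (mem_cell_iff.1 (show y ∈ cell x i from hi) k)
    fun h => hk ((mem_nearest_iff hi).2 h.symm)

theorem isClosed_cell (i : Fin N) : IsClosed (cell x i) := by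
  have : cell x i = ⋂ k, {y | 0 ≤ gap x i k y} := by
    ext y; simp [mem_cell_iff]
  rw [this]
  exact isClosed_iInter fun k => isClosed_le continuous_const (continuous_gap i k)

theorem convex_cell (i : Fin N) : Convex ℝ (cell x i) := by
  have : cell x i = ⋂ k, gap x i k ⁻¹' Set.Ici 0 := by
    ext y; simp [mem_cell_iff]
  rw [this]
  exact convex_iInter fun k => (convex_Ici 0).affine_preimage _

theorem face_eq_iInter (η : Finset (Fin N)) : face x η = ⋂ k ∈ η, cell x k := by
  ext y; simp [face]

theorem isClosed_face (η : Finset (Fin N)) : IsClosed (face x η) := by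
  rw [face_eq_iInter]
  exact isClosed_biInter fun k _ => isClosed_cell k

theorem convex_face (η : Finset (Fin N)) : Convex ℝ (face x η) := by
  rw [face_eq_iInter]
  exact convex_iInter₂ fun k _ => convex_cell k

theorem face_anti {η η' : Finset (Fin N)} (h : η ⊆ η') : face x η' ⊆ face x η :=
  fun _ hy k hk => hy k (h hk)

theorem isCompact_face {η : Finset (Fin N)} (hb : Bornology.IsBounded (face x η)) :
    IsCompact (face x η) :=
  Metric.isCompact_of_isClosed_isBounded (isClosed_face η) hb

theorem face_singleton (i : Fin N) : face x {i} = cell x i := by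
  ext y; simp [face]

theorem face_pair (i j : Fin N) : face x {i, j} = cell x i ∩ cell x j := by
  ext y; simp [face]

/-- From a point of a face one can move a little in every admissible direction. -/
theorem exists_add_smul_mem_face {η : Finset (Fin N)} {i : Fin N} (hi : i ∈ η) {y u : Pt d}
    (hy : y ∈ face x η) (h0 : ∀ k ∈ η, inner ℝ (x k - x i) u = 0)
    (h1 : ∀ k ∈ nearest x y, inner ℝ (x k - x i) u ≤ 0) :
    ∃ ε : ℝ, 0 < ε ∧ y + ε • u ∈ face x η := by
  have hin : i ∈ nearest x y := hy i hi
  have hev : ∀ᶠ t in nhdsWithin (0 : ℝ) (Set.Ioi 0), ∀ k, 0 ≤ gap x i k (y + t • u) := by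
    refine Filter.eventually_all.2 fun k => ?_
    by_cases hk : k ∈ nearest x y
    · filter_upwards [self_mem_nhdsWithin] with t ht
      rw [gap_add_smul, (mem_nearest_iff hin).1 hk]
      have := h1 k hk
      have ht' : (0 : ℝ) < t := ht
      nlinarith
    · have hc : Continuous fun t : ℝ => gap x i k (y + t • u) :=
        (continuous_gap i k).comp (by fun_prop)
      have : 0 < gap x i k (y + (0 : ℝ) • u) := by simpa using gap_pos hin hk
      filter_upwards [nhdsWithin_le_nhds (hc.continuousAt.eventually (lt_mem_nhds this))] with t ht
      exact ht.le
  obtain ⟨ε, hε, hε0⟩ := (hev.and self_mem_nhdsWithin).exists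
  refine ⟨ε, hε0, (mem_face_iff hi).2 ⟨hε, fun k hk => ?_⟩⟩
  rw [gap_add_smul, ((mem_face_iff hi).1 hy).2 k hk, h0 k hk]; ring

theorem vectorSpan_eq_span_sub {σ : Finset (Fin N)} {i : Fin N} (hi : i ∈ σ) :
    vectorSpan ℝ (Set.range fun k : σ => x k) =
      Submodule.span ℝ {v | ∃ k ∈ σ, v = x k - x i} := by
  rw [vectorSpan_eq_span_vsub_set_right ℝ (Set.mem_range_self (⟨i, hi⟩ : σ))]
  congr 1
  ext v
  simp only [Set.mem_image, Set.mem_range, Subtype.exists, vsub_eq_sub, Set.mem_ofPred_eq]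
  constructor
  · rintro ⟨_, ⟨k, hk, rfl⟩, rfl⟩; exact ⟨k, hk, rfl⟩
  · rintro ⟨k, hk, rfl⟩; exact ⟨_, ⟨k, hk, rfl⟩, rfl⟩

theorem IsVertex.mem_iff {σ : Finset (Fin N)} {r : Pt d} (h : IsVertex x σ r) {k : Fin N} :
    k ∈ σ ↔ k ∈ nearest x r := by
  rw [← h.1]; simp

theorem IsVertex.mem_face {σ η : Finset (Fin N)} {r : Pt d} (h : IsVertex x σ r) :
    r ∈ face x η ↔ η ⊆ σ := by
  rw [mem_face_iff_subset_nearest, ← h.1, Finset.coe_subset]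

/-- The differences of `d + 1` affinely independent nodes span `ℝ^d`. Hence a point is determined by
its values of `gap x i k`, `k ∈ σ`. -/
theorem IsVertex.eq_zero_of_inner_eq_zero {σ : Finset (Fin N)} {r : Pt d} (h : IsVertex x σ r)
    {i : Fin N} (hi : i ∈ σ) {u : Pt d} (hu : ∀ k ∈ σ, inner ℝ (x k - x i) u = 0) : u = 0 := by
  have htop : vectorSpan ℝ (Set.range fun k : σ => x k) = ⊤ := by
    apply h.2.2.vectorSpan_eq_top_of_card_eq_finrank_add_one
    rw [Fintype.card_coe, h.2.1, finrank_euclideanSpace, Fintype.card_fin]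
  have hmem : u ∈ Submodule.span ℝ {v | ∃ k ∈ σ, v = x k - x i} := by
    rw [← vectorSpan_eq_span_sub hi, htop]; exact Submodule.mem_top
  have : ∀ v ∈ Submodule.span ℝ {v | ∃ k ∈ σ, v = x k - x i}, inner ℝ v u = 0 := by
    intro v hv
    induction hv using Submodule.span_induction with
    | mem v hv => obtain ⟨k, hk, rfl⟩ := hv; exact hu k hk
    | zero => simp
    | add v w _ _ hv hw => rw [inner_add_left, hv, hw, add_zero]
    | smul a v _ hv => rw [inner_smul_left, hv, mul_zero]
  exact inner_self_eq_zero.1 (this u hmem)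

/-- The direction of the edge that leaves `r` away from `x k`. Without it `x k - x i` would lie in
the double orthogonal complement, hence in the span, of the other differences. -/
theorem IsVertex.exists_direction {σ : Finset (Fin N)} {r : Pt d} (h : IsVertex x σ r)
    {i k : Fin N} (hi : i ∈ σ) (hk : k ∈ σ) (hik : i ≠ k) :
    ∃ u : Pt d, (∀ l ∈ σ, l ≠ k → inner ℝ (x l - x i) u = 0) ∧ inner ℝ (x k - x i) u < 0 := by
  by_contra! hcon
  set W : Submodule ℝ (Pt d) := Submodule.span ℝ {v | ∃ l ∈ σ, l ≠ k ∧ v = x l - x i} with hW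
  have hmem : x k - x i ∈ Wᗮᗮ := by
    rw [Submodule.mem_orthogonal]
    intro u hu
    have h1 : ∀ l ∈ σ, l ≠ k → inner ℝ (x l - x i) u = 0 := fun l hl hlk =>
      (Submodule.mem_orthogonal _ _).1 hu _ (Submodule.subset_span ⟨l, hl, hlk, rfl⟩)
    have h2 := hcon u h1
    have h3 := hcon (-u) fun l hl hlk => by rw [inner_neg_right, h1 l hl hlk, neg_zero]
    rw [inner_neg_right] at h3
    rw [real_inner_comm]; linarith
  rw [Submodule.orthogonal_orthogonal] at hmem
  have hli := (affineIndependent_iff_linearIndependent_vsub ℝ _ (⟨i, hi⟩ : σ)).1 h.2.2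
  have hk' : (⟨k, hk⟩ : σ) ≠ ⟨i, hi⟩ := fun h' => hik (congrArg Subtype.val h').symm
  refine hli.notMem_span_image (s := {l | l.1 ≠ ⟨k, hk⟩}) (x := ⟨⟨k, hk⟩, hk'⟩)
    (by simp) ?_
  refine Submodule.span_le.2 ?_ hmem
  rintro _ ⟨l, hl, hlk, rfl⟩
  by_cases hli' : l = i
  · subst hli'; simp
  · refine Submodule.subset_span ⟨⟨⟨l, hl⟩, fun h' => hli' (congrArg Subtype.val h')⟩, ?_, rfl⟩
    exact fun h' => hlk (congrArg Subtype.val h')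

/-- In general position the extreme points of the faces are vertices. -/
theorem isVertex_of_mem_extremePoints (hX : GeneralPosition x) {η : Finset (Fin N)}
    (hη : η.Nonempty) {r : Pt d} (hr : r ∈ (face x η).extremePoints ℝ) :
    ∃ σ, IsVertex x σ r ∧ η ⊆ σ := by
  classical
  obtain ⟨i, hi⟩ := hη
  obtain ⟨hrf, hext⟩ := hr
  set σ : Finset (Fin N) := (nearest x r).toFinset with hσ
  have hσc : (σ : Set (Fin N)) = nearest x r := by simp [hσ]
  have hmem : ∀ k, k ∈ σ ↔ k ∈ nearest x r := fun k => by simp [hσ]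
  have hησ : η ⊆ σ := fun k hk => (hmem k).2 (hrf k hk)
  have hiσ := hησ hi
  have hcard : σ.card ≤ d + 1 := by
    rw [← Set.ncard_coe_finset, hσc]; exact hX.2 r
  -- A vector `u` orthogonal to all differences of nearest nodes could be followed both ways within
  -- the face, so `r` would be the interior point of a segment.
  have htop : vectorSpan ℝ (Set.range fun k : σ => x k) = ⊤ := by
    rw [vectorSpan_eq_span_sub hiσ, ← Submodule.orthogonal_eq_bot_iff, Submodule.eq_bot_iff]
    intro u hu
    have h0 : ∀ k ∈ σ, inner ℝ (x k - x i) u = 0 := fun k hk =>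
      (Submodule.mem_orthogonal _ _).1 hu _ (Submodule.subset_span ⟨k, hk, rfl⟩)
    obtain ⟨ε, hε, h1⟩ := exists_add_smul_mem_face hi hrf (u := u) (fun k hk => h0 k (hησ hk))
      fun k hk => (h0 k ((hmem k).2 hk)).le
    obtain ⟨δ, hδ, h2⟩ := exists_add_smul_mem_face hi hrf (u := -u)
      (fun k hk => by rw [inner_neg_right, h0 k (hησ hk), neg_zero])
      fun k hk => by rw [inner_neg_right, h0 k ((hmem k).2 hk), neg_zero]
    have hopen : r ∈ openSegment ℝ (r + ε • u) (r + δ • -u) := by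
      refine ⟨δ / (ε + δ), ε / (ε + δ), by positivity, by positivity, by field_simp; ring, ?_⟩
      match_scalars <;> field_simp <;> ring
    have := hext h1 h2 hopen
    rw [add_eq_left, smul_eq_zero] at this
    exact this.resolve_left hε.ne'
  have hne : Nonempty σ := ⟨⟨i, hiσ⟩⟩
  -- Spanning `ℝ^d` takes at least `d + 1` nodes and general position allows no more, so they are
  -- affinely independent.
  have hfr := finrank_vectorSpan_range_le ℝ (fun k : σ => x k) (n := σ.card - 1)
    (by rw [Fintype.card_coe]; have := Finset.card_pos.2 ⟨i, hiσ⟩; omega)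
  rw [htop, finrank_top, finrank_euclideanSpace, Fintype.card_fin] at hfr
  have hpos := Finset.card_pos.2 ⟨i, hiσ⟩
  have hcard' : σ.card = d + 1 := by omega
  refine ⟨σ, ⟨hσc, hcard', ?_⟩, hησ⟩
  rw [affineIndependent_iff_finrank_vectorSpan_eq ℝ _ (n := d) (by rw [Fintype.card_coe, hcard']),
    htop, finrank_top, finrank_euclideanSpace, Fintype.card_fin]

theorem exists_isVertex (hX : GeneralPosition x) {η : Finset (Fin N)} (hη : η.Nonempty)
    (hb : Bornology.IsBounded (face x η)) (hne : (face x η).Nonempty) :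
    ∃ σ r, IsVertex x σ r ∧ η ⊆ σ := by
  obtain ⟨r, hr⟩ := (isCompact_face hb).extremePoints_nonempty hne
  obtain ⟨σ, h⟩ := isVertex_of_mem_extremePoints hX hη hr
  exact ⟨σ, r, h⟩

/-- A bounded face is contained in every closed convex set which contains its vertices. -/
theorem face_subset_of_vertices (hX : GeneralPosition x) {η : Finset (Fin N)} (hη : η.Nonempty)
    (hb : Bornology.IsBounded (face x η)) {C : Set (Pt d)} (hC : Convex ℝ C) (hC' : IsClosed C)
    (h : ∀ σ r, IsVertex x σ r → η ⊆ σ → r ∈ C) : face x η ⊆ C := by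
  rw [← closure_convexHull_extremePoints (isCompact_face hb) (convex_face η)]
  refine closure_minimal (convexHull_min ?_ hC) hC'
  intro r hr
  obtain ⟨σ, hσ, hησ⟩ := isVertex_of_mem_extremePoints hX hη hr
  exact h σ r hσ hησ

/-- A bounded face has a vertex outside the cell of any given further node. -/
theorem exists_isVertex_notMem (hX : GeneralPosition x) {η : Finset (Fin N)} (hη : η.Nonempty)
    (hb : Bornology.IsBounded (face x η)) (hne : (face x η).Nonempty) {k : Fin N} (hk : k ∉ η) :
    ∃ σ r, IsVertex x σ r ∧ η ⊆ σ ∧ k ∉ σ := by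
  by_contra! hcon
  obtain ⟨σ, r, hσ, hησ⟩ := exists_isVertex hX hη hb hne
  have hkσ := hcon σ r hσ hησ
  obtain ⟨i, hi⟩ := hη
  have hik : i ≠ k := by rintro rfl; exact hk hi
  -- If all vertices had the generator `k`, the whole face would lie in the bisector `gap x i k =
  -- 0`; the edge leaving `r` away from `x k` stays in the face but leaves this bisector.
  obtain ⟨u, hu, huk⟩ := hσ.exists_direction (hησ hi) hkσ hik
  have hu0 : ∀ l ∈ σ, inner ℝ (x l - x i) u ≤ 0 := fun l hl => by
    by_cases hlk : l = k
    · rw [hlk]; exact huk.le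
    · exact (hu l hl hlk).le
  obtain ⟨ε, hε, hmem⟩ := exists_add_smul_mem_face hi (hσ.mem_face.2 hησ)
    (fun l hl => hu l (hησ hl) (by rintro rfl; exact hk hl))
    (fun l hl => hu0 l (hσ.mem_iff.2 hl))
  have hsub := face_subset_of_vertices hX ⟨i, hi⟩ hb (C := gap x i k ⁻¹' {0})
    ((convex_singleton 0).affine_preimage _) (isClosed_singleton.preimage (continuous_gap i k))
    fun σ' r' hσ' hησ' => (mem_nearest_iff (hσ'.mem_iff.1 (hησ' hi))).1
      (hσ'.mem_iff.1 (hcon σ' r' hσ' hησ'))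
  have h1 : gap x i k (r + ε • u) = 0 := hsub hmem
  rw [gap_add_smul, (mem_nearest_iff (hσ.mem_iff.1 (hησ hi))).1 (hσ.mem_iff.1 hkσ)] at h1
  nlinarith

theorem IsVertex.eq_of_subset {σ : Finset (Fin N)} {r r' : Pt d} (h : IsVertex x σ r)
    (h' : (σ : Set (Fin N)) ⊆ nearest x r') : r' = r := by
  obtain ⟨i, hi⟩ : σ.Nonempty := Finset.card_pos.1 (by rw [h.2.1]; omega)
  have hin := h.mem_iff.1 hi
  rw [← sub_eq_zero]
  refine h.eq_zero_of_inner_eq_zero hi fun k hk => ?_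
  have h1 := (mem_nearest_iff hin).1 (h.mem_iff.1 hk)
  have h2 := (mem_nearest_iff (h' hi)).1 (h' hk)
  rw [gap_apply'] at h1 h2
  rw [inner_sub_right]; linarith

theorem IsVertex.inj {σ : Finset (Fin N)} {r r' : Pt d} (h : IsVertex x σ r)
    (h' : IsVertex x σ r') : r' = r := h.eq_of_subset h'.1.le

theorem IsVertex.inj_left {σ σ' : Finset (Fin N)} {r : Pt d} (h : IsVertex x σ r)
    (h' : IsVertex x σ' r) : σ' = σ := by
  rw [← Finset.coe_inj, h.1, h'.1]

/-- Two vertices of an edge: the edge is the segment between them, and they are its only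
vertices. -/
theorem edge_eq_segment {η σ τ : Finset (Fin N)} {v w : Pt d} (hd : 1 ≤ d) (hη : η.card = d)
    (hv : IsVertex x σ v) (hw : IsVertex x τ w) (hησ : η ⊆ σ) (hητ : η ⊆ τ) (hne : v ≠ w) :
    face x η = segment ℝ v w := by
  classical
  have hστ : σ ≠ τ := by rintro rfl; exact hne (hw.inj hv)
  obtain ⟨i, hi⟩ : η.Nonempty := Finset.card_pos.1 (by omega)
  obtain ⟨a, haσ, haτ⟩ : ∃ a ∈ σ, a ∉ τ := by
    by_contra! h
    exact hστ (Finset.eq_of_subset_of_card_le h (by rw [hv.2.1, hw.2.1]))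
  obtain ⟨b, hbτ, hbσ⟩ : ∃ b ∈ τ, b ∉ σ := by
    by_contra! h
    exact hστ (Finset.eq_of_subset_of_card_le h (by rw [hv.2.1, hw.2.1])).symm
  have hσ : σ = insert a η := by
    refine (Finset.eq_of_subset_of_card_le (Finset.insert_subset haσ hησ) ?_).symm
    rw [Finset.card_insert_of_notMem fun h => haτ (hητ h), hη, hv.2.1]
  have hiv := hv.mem_iff.1 (hησ hi)
  have hiw := hw.mem_iff.1 (hητ hi)
  have hav : gap x i a v = 0 := (mem_nearest_iff hiv).1 (hv.mem_iff.1 haσ)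
  have haw : 0 < gap x i a w := gap_pos hiw fun h => haτ (hw.mem_iff.2 h)
  have hbw : gap x i b w = 0 := (mem_nearest_iff hiw).1 (hw.mem_iff.1 hbτ)
  have hbv : 0 < gap x i b v := gap_pos hiv fun h => hbσ (hv.mem_iff.2 h)
  have hvf := hv.mem_face.2 hησ
  have hwf := hw.mem_face.2 hητ
  refine Set.Subset.antisymm (fun y hy => ?_) ((convex_face η).segment_subset hvf hwf)
  have hyf := (mem_face_iff hi).1 hy
  set s := gap x i a y / gap x i a w with hs
  -- The parameter `s` is chosen to match the gap of `a`; the gaps of `η` vanish on the face. As `σ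
  -- = insert a η`, the two points coincide.
  have hy' : y = AffineMap.lineMap v w s := by
    rw [← sub_eq_zero]
    refine hv.eq_zero_of_inner_eq_zero (hησ hi) fun k hk => ?_
    have key : gap x i k y = gap x i k (AffineMap.lineMap v w s) := by
      rw [apply_lineMap]
      rw [hσ, Finset.mem_insert] at hk
      rcases hk with rfl | hk
      · rw [hav, hs]; field_simp; ring
      · rw [hyf.2 k hk, ((mem_face_iff hi).1 hvf).2 k hk, ((mem_face_iff hi).1 hwf).2 k hk]; ring
    rw [gap_apply', gap_apply'] at key
    rw [inner_sub_right]; linarith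
  rw [segment_eq_image_lineMap]
  refine ⟨s, ⟨div_nonneg (hyf.1 a) haw.le, ?_⟩, hy'.symm⟩
  -- The gap of `b` vanishes at `w` and is positive at `v`, so its sign bounds `s` by `1`.
  have := hyf.1 b
  rw [hy', apply_lineMap, hbw, mul_zero, add_zero] at this
  nlinarith

/-- The gaps are nonnegative at both ends, so one vanishing strictly between them vanishes at both.
Then `v` and `w` would share all generators of `u`, and these determine a single point. -/
theorem edge_vertex_eq {η σ τ ρ : Finset (Fin N)} {v w u : Pt d} (hd : 1 ≤ d) (hη : η.card = d)
    (hv : IsVertex x σ v) (hw : IsVertex x τ w) (hu : IsVertex x ρ u)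
    (hησ : η ⊆ σ) (hητ : η ⊆ τ) (hηρ : η ⊆ ρ) (hne : v ≠ w) : u = v ∨ u = w := by
  have hseg := edge_eq_segment hd hη hv hw hησ hητ hne
  have hmem : u ∈ segment ℝ v w := hseg ▸ hu.mem_face.2 hηρ
  by_contra! hcon
  obtain ⟨s, hs, rfl⟩ := (segment_eq_image_lineMap ℝ v w) ▸ hmem
  have hs0 : 0 < s := lt_of_le_of_ne hs.1 (by rintro rfl; simp at hcon)
  have hs1 : s < 1 := lt_of_le_of_ne hs.2 (by rintro rfl; simp at hcon)
  obtain ⟨i, hi⟩ : η.Nonempty := Finset.card_pos.1 (by omega)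
  have hin : ∀ k ∈ ρ, k ∈ nearest x v ∧ k ∈ nearest x w := by
    intro k hk
    have hiv := hv.mem_iff.1 (hησ hi)
    have hiw := hw.mem_iff.1 (hητ hi)
    have h0 := (mem_nearest_iff (hu.mem_iff.1 (hηρ hi))).1 (hu.mem_iff.1 hk)
    have h1 := mem_cell_iff.1 (show v ∈ cell x i from hiv) k
    have h2 := mem_cell_iff.1 (show w ∈ cell x i from hiw) k
    rw [apply_lineMap] at h0
    rw [mem_nearest_iff hiv, mem_nearest_iff hiw]
    constructor <;> nlinarith
  exact hne ((hu.eq_of_subset fun k hk => (hin k hk).1).trans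
    (hu.eq_of_subset fun k hk => (hin k hk).2).symm)

/-! ### Decomposition of a face into cones over its facets -/

/-- For `k ∉ η` the gap is positive at `m` and nonnegative at `z`, hence positive before `z` is
reached. -/
theorem nearest_lineMap {η : Finset (Fin N)} (hη : η.Nonempty) {m z : Pt d}
    (hm : nearest x m = η) (hz : z ∈ face x η) {t : ℝ} (ht0 : 0 ≤ t) (ht1 : t < 1) :
    nearest x (AffineMap.lineMap m z t) = η := by
  obtain ⟨i, hi⟩ := hη
  have him : i ∈ nearest x m := by rw [hm]; exact hi
  have hmf : m ∈ face x η := mem_face_iff_subset_nearest.2 hm.ge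
  have hyf : AffineMap.lineMap m z t ∈ face x η :=
    (convex_face η).segment_subset hmf hz
      ((segment_eq_image_lineMap ℝ m z).symm ▸ ⟨t, ⟨ht0, ht1.le⟩, rfl⟩)
  refine Set.Subset.antisymm (fun k hk => ?_) (mem_face_iff_subset_nearest.1 hyf)
  by_contra hkη
  have h1 := (mem_nearest_iff (hyf i hi)).1 hk
  have h2 := gap_pos him (k := k) (by rw [hm]; exact hkη)
  have h3 := ((mem_face_iff hi).1 hz).1 k
  rw [apply_lineMap] at h1
  nlinarith

/-- The ray from `m` through `y` leaves the face where the first gap of a node outside `η` vanishes;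
this exit point lies in a facet. -/
theorem face_eq_iUnion_join {η : Finset (Fin N)} (hη : η.Nonempty)
    (hb : Bornology.IsBounded (face x η)) {m : Pt d} (hm : nearest x m = η)
    (hfacet : ∃ j ∉ η, (face x (insert j η)).Nonempty) :
    face x η = ⋃ j : {j // j ∉ η}, join m (face x (insert j.1 η)) := by
  have hmf : m ∈ face x η := mem_face_iff_subset_nearest.2 hm.ge
  refine Set.Subset.antisymm (fun y hy => ?_) (Set.iUnion_subset ?_)
  · obtain ⟨i, hi⟩ := hη
    have him : i ∈ nearest x m := by rw [hm]; exact hi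
    have hpos : ∀ k ∉ η, 0 < gap x i k m := fun k hk => gap_pos him (by rw [hm]; exact hk)
    have hmf' := (mem_face_iff hi).1 hmf
    have hyf := (mem_face_iff hi).1 hy
    obtain ⟨j₀, hj₀, z₀, hz₀⟩ := hfacet
    simp only [Set.mem_iUnion, Subtype.exists]
    obtain ⟨j, hj, hjmin⟩ := Finset.exists_min_image (Finset.univ.filter (· ∉ η))
      (fun k => gap x i k y / gap x i k m) ⟨j₀, by simpa using hj₀⟩
    simp only [Finset.mem_filter, Finset.mem_univ, true_and] at hj hjmin
    -- By minimality of the ratio, the gap of each `k ∉ η` at parameter `t ≥ 0` of the ray is at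
    -- least `(1 - t * s)` times its value at `m`, with equality for `j`. For `0 < s` the exit
    -- parameter is therefore `s⁻¹`.
    set s := 1 - gap x i j y / gap x i j m with hs
    have hge : ∀ k ∉ η, (1 - s) * gap x i k m ≤ gap x i k y := by
      intro k hk
      have := hjmin k hk
      rw [hs, sub_sub_cancel]
      rwa [le_div_iff₀ (hpos k hk)] at this
    have hs1 : s ≤ 1 := by
      have := div_nonneg (hyf.1 j) (hpos j hj).le
      linarith
    have hjy : gap x i j y = (1 - s) * gap x i j m := by
      have := (hpos j hj).ne'
      rw [hs]; field_simp; ring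
    rcases lt_or_ge 0 s with hs0 | hs0
    · refine ⟨j, hj, s, ⟨hs0.le, hs1⟩, AffineMap.lineMap m y s⁻¹, ?_, ?_⟩
      · refine (mem_face_iff (Finset.mem_insert_of_mem hi)).2 ⟨fun k => ?_, fun k hk => ?_⟩
        · rw [apply_lineMap]
          by_cases hk : k ∈ η
          · rw [hmf'.2 k hk, hyf.2 k hk]; simp
          · have h1 := hge k hk
            have : (1 - s⁻¹) * gap x i k m + s⁻¹ * gap x i k y =
              s⁻¹ * (gap x i k y - (1 - s) * gap x i k m) := by field_simp; ring
            rw [this]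
            exact mul_nonneg (inv_nonneg.2 hs0.le) (by linarith)
        · rw [apply_lineMap]
          rcases Finset.mem_insert.1 hk with rfl | hk
          · rw [hjy]; field_simp; ring
          · rw [hmf'.2 k hk, hyf.2 k hk]; simp
      · simp only [AffineMap.lineMap_apply_module]
        match_scalars <;> field_simp
        ring
    -- For `s ≤ 0` no gap ever reaches zero, and a bounded face contains no ray.
    · have hym : y = m := by
        by_contra hne
        obtain ⟨C, hC⟩ := hb.exists_norm_le
        have hray : ∀ t : ℝ, 0 ≤ t → AffineMap.lineMap m y t ∈ face x η := by
          intro t ht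
          refine (mem_face_iff hi).2 ⟨fun k => ?_, fun k hk => ?_⟩
          · rw [apply_lineMap]
            by_cases hk : k ∈ η
            · rw [hmf'.2 k hk, hyf.2 k hk]; simp
            · have h1 := hge k hk
              have h2 := hpos k hk
              nlinarith [mul_nonneg ht (sub_nonneg.2 h1),
                mul_nonneg (mul_nonneg ht (neg_nonneg.2 hs0)) h2.le]
          · rw [apply_lineMap, hmf'.2 k hk, hyf.2 k hk]; simp
        have hym0 : 0 < ‖y - m‖ := norm_pos_iff.2 (sub_ne_zero.2 hne)
        have hC0 : 0 ≤ C := (norm_nonneg m).trans (hC m hmf)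
        -- This parameter gives a point at distance `2 * C + 1` from `m`, too far for two points of
        -- norm at most `C`.
        have h1 := hC _ (hray ((2 * C + 1) / ‖y - m‖) (by positivity))
        rw [AffineMap.lineMap_apply_module', add_comm] at h1
        have h2 := norm_sub_le (m + ((2 * C + 1) / ‖y - m‖) • (y - m)) m
        rw [add_sub_cancel_left, norm_smul, Real.norm_of_nonneg (by positivity),
          div_mul_cancel₀ _ hym0.ne'] at h2
        have h3 := hC m hmf
        linarith
      -- The apex is the parameter `0` of a cone over any nonempty facet.
      exact ⟨j₀, hj₀, 0, ⟨le_rfl, zero_le_one⟩, z₀, hz₀, by simp [hym]⟩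
  · rintro ⟨j, hj⟩ _ ⟨t, ht, z, hz, rfl⟩
    exact (convex_face η).segment_subset hmf (face_anti (Finset.subset_insert _ _) hz)
      ((segment_eq_image_lineMap ℝ m z).symm ▸ ⟨t, ht, rfl⟩)

theorem exists_facet (hX : GeneralPosition x) {η : Finset (Fin N)} (hη : η.Nonempty)
    (hcard : η.card ≤ d) (hb : Bornology.IsBounded (face x η)) (hne : (face x η).Nonempty) :
    ∃ j ∉ η, (face x (insert j η)).Nonempty := by
  obtain ⟨σ, r, hσ, hησ⟩ := exists_isVertex hX hη hb hne
  obtain ⟨j, hj, hjη⟩ : ∃ j ∈ σ, j ∉ η := by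
    by_contra! h
    have := Finset.card_le_card h
    rw [hσ.2.1] at this
    omega
  exact ⟨j, hjη, r, hσ.mem_face.2 (Finset.insert_subset hj hησ)⟩

/-- The affine functional which is `1` at `m` and vanishes on the facet with the further node
`j`. -/
def facetCoord (x : Fin N → Pt d) (i j : Fin N) (m : Pt d) : Pt d →ᵃ[ℝ] ℝ :=
  (gap x i j m)⁻¹ • gap x i j

theorem facetCoord_apply (i j : Fin N) (m y : Pt d) :
    facetCoord x i j m y = (gap x i j m)⁻¹ * gap x i j y := rfl

theorem facetCoord_apex {η : Finset (Fin N)} {m : Pt d} (hm : nearest x m = η) {i j : Fin N}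
    (hi : i ∈ η) (hj : j ∉ η) : facetCoord x i j m m = 1 := by
  rw [facetCoord_apply]
  exact inv_mul_cancel₀ (gap_pos (by rw [hm]; exact hi) (by rw [hm]; exact hj)).ne'

theorem facetCoord_eq_zero {η : Finset (Fin N)} {m z : Pt d} {i j : Fin N}
    (hi : i ∈ η) (hz : z ∈ face x (insert j η)) : facetCoord x i j m z = 0 := by
  rw [facetCoord_apply, ((mem_face_iff (Finset.mem_insert_of_mem hi)).1 hz).2 j
    (Finset.mem_insert_self _ _), mul_zero]

theorem facetCoord_nonneg {η : Finset (Fin N)} {m z : Pt d} (hm : nearest x m = η) {i : Fin N}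
    (hi : i ∈ η) (j : Fin N) (hz : z ∈ face x η) : 0 ≤ facetCoord x i j m z := by
  have hmf : m ∈ face x η := mem_face_iff_subset_nearest.2 hm.ge
  rw [facetCoord_apply]
  exact mul_nonneg (inv_nonneg.2 (((mem_face_iff hi).1 hmf).1 j)) (((mem_face_iff hi).1 hz).1 j)

theorem AffineExtendable.facet {P : List (Pt d)} {η : Finset (Fin N)} (hη : η.Nonempty)
    (hP : AffineExtendable P (face x η)) {m : Pt d} (hm : nearest x m = η) {j : Fin N}
    (hj : j ∉ η) : AffineExtendable (m :: P) (face x (insert j η)) := by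
  obtain ⟨i, hi⟩ := hη
  exact hP.cons (mem_face_iff_subset_nearest.2 hm.ge) (face_anti (Finset.subset_insert _ _))
    (facetCoord x i j m) (facetCoord_apex hm hi hj) fun z hz => facetCoord_eq_zero hi hz

/-- The cones over different facets overlap in a null set. -/
theorem volume_joins_facet_inter (hX : GeneralPosition x) {P : List (Pt d)} {η : Finset (Fin N)}
    (hη : η.Nonempty) (hb : Bornology.IsBounded (face x η)) (hP : AffineExtendable P (face x η))
    {m : Pt d} (hm : nearest x m = η) {j k : Fin N} (hj : j ∉ η) (hk : k ∉ η) (hjk : j ≠ k) :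
    volume (joins (m :: P) (face x (insert j η)) ∩ joins (m :: P) (face x (insert k η))) = 0 := by
  rcases (face x (insert j η)).eq_empty_or_nonempty with he | hne
  · rw [he, joins_empty]; simp
  have hsubj : face x (insert j η) ⊆ face x η := face_anti (Finset.subset_insert _ _)
  have hsubk : face x (insert k η) ⊆ face x η := face_anti (Finset.subset_insert _ _)
  obtain ⟨σ, r, hσ, hησ, hkσ⟩ := exists_isVertex_notMem hX (Finset.insert_nonempty j η)
    (hb.subset hsubj) hne (k := k) (by simp [hk, hjk.symm])
  obtain ⟨i, hi⟩ := hη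
  -- On the facet `j` this difference is minus the nonnegative coordinate of `k`, on the facet `k`
  -- it is the coordinate of `j`, and it vanishes at `m`. Extended by zero to the apexes `P`, it is
  -- `≤ 0` on one iterated cone and `≥ 0` on the other, so they meet inside its zero set, a
  -- hyperplane because `g r ≠ 0`.
  obtain ⟨g, hgP, hg⟩ := hP (facetCoord x i j m - facetCoord x i k m)
  have hmf : m ∈ face x η := mem_face_iff_subset_nearest.2 hm.ge
  have hgm : g m = 0 := by
    rw [hg m hmf]
    simp [facetCoord_apex hm hi hj, facetCoord_apex hm hi hk]
  have hrf : r ∈ face x (insert j η) := hσ.mem_face.2 hησ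
  have hgr : g r ≠ 0 := by
    rw [hg r (hsubj hrf)]
    have h1 := gap_pos (hσ.mem_iff.1 (hησ (Finset.mem_insert_of_mem hi)))
      fun h => hkσ (hσ.mem_iff.2 h)
    have h2 := gap_pos (x := x) (y := m) (i := i) (k := k) (by rw [hm]; exact hi)
      (by rw [hm]; exact hk)
    have h3 : 0 < (gap x i k m)⁻¹ * gap x i k r := mul_pos (inv_pos.2 h2) h1
    simp only [AffineMap.coe_sub, Pi.sub_apply, facetCoord_eq_zero hi hrf]
    rw [facetCoord_apply]
    linarith
  refine measure_mono_null ?_ (volume_affine_eq_zero g hgr)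
  rintro y ⟨hyj, hyk⟩
  have hPm : ∀ p ∈ m :: P, g p = 0 := by
    rintro p hp
    rcases List.mem_cons.1 hp with rfl | hp
    exacts [hgm, hgP p hp]
  refine le_antisymm (affine_nonpos_of_mem_joins g _ (fun p hp => (hPm p hp).le) ?_ y hyj) ?_
  · intro z hz
    rw [hg z (hsubj hz)]
    have := facetCoord_nonneg hm hi k (hsubj hz)
    simp [facetCoord_eq_zero hi hz, this]
  · have := affine_nonpos_of_mem_joins (-g) (m :: P) (fun p hp => by simp [hPm p hp])
      (fun z hz => by
        have := facetCoord_nonneg hm hi j (hsubk hz)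
        simp [hg z (hsubk hz), facetCoord_eq_zero hi hz, this]) y hyk
    simpa using this

/-- The cone decomposition of a face, suspended from further apexes. -/
theorem joins_face_eq_iUnion (hX : GeneralPosition x) (P : List (Pt d)) {η : Finset (Fin N)}
    (hη : η.Nonempty) (hcard : η.card ≤ d) (hb : Bornology.IsBounded (face x η)) {m : Pt d}
    (hm : nearest x m = η) :
    joins P (face x η) = ⋃ j : {j // j ∉ η}, joins (m :: P) (face x (insert j.1 η)) := by
  rw [face_eq_iUnion_join hη hb hm (exists_facet hX hη hcard hb
    ⟨m, mem_face_iff_subset_nearest.2 hm.ge⟩), joins_iUnion]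
  rfl

theorem setIntegral_joins_face (hX : GeneralPosition x) {P : List (Pt d)} {η : Finset (Fin N)}
    (hη : η.Nonempty) (hcard : η.card ≤ d) (hb : Bornology.IsBounded (face x η)) {m : Pt d}
    (hm : nearest x m = η) (hP : AffineExtendable P (face x η)) {F : Pt d → ℝ}
    (hF : IntegrableOn F (joins P (face x η))) :
    ∫ y in joins P (face x η), F y =
      ∑ j ∈ ηᶜ, ∫ y in joins (m :: P) (face x (insert j η)), F y := by
  have hU := joins_face_eq_iUnion hX P hη hcard hb hm
  rw [hU] at hF ⊢
  rw [integral_iUnion_ae (fun j => ((isCompact_joins _ (isCompact_face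
      (hb.subset (face_anti (Finset.subset_insert _ _))))).measurableSet).nullMeasurableSet)
    (fun j k hjk => volume_joins_facet_inter hX hη hb hP hm j.2 k.2
      fun h => hjk (Subtype.ext h)) hF, tsum_fintype]
  rw [Finset.sum_subtype (p := fun j => j ∉ η) ηᶜ (by simp)
    (fun j => ∫ y in joins (m :: P) (face x (insert j η)), F y)]

/-! ### The stored vertices of a face and its simplices -/

variable {M : Mesh d N}

theorem mem_faceVertices (hM : M.IsComplete) {η : Finset (Fin N)} {v : Finset (Fin N) × Pt d} :
    v ∈ M.faceVertices η ↔ IsVertex M.nodes v.1 v.2 ∧ η ⊆ v.1 := by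
  simp only [Mesh.faceVertices, List.mem_filter, decide_eq_true_eq]
  rw [← hM.mem_vertices v.1 v.2]

theorem having_vertices (M : Mesh d N) (i : Fin N) :
    having i M.vertices = M.faceVertices {i} := by
  simp [having, Mesh.faceVertices]

theorem having_faceVertices (M : Mesh d N) (j : Fin N) (η : Finset (Fin N)) :
    having j (M.faceVertices η) = M.faceVertices (insert j η) := by
  simp only [having, Mesh.faceVertices, List.filter_filter, Finset.insert_subset_iff,
    Bool.decide_and]

theorem faceVertices_ne_nil (hX : GeneralPosition M.nodes) (hM : M.IsComplete)
    {η : Finset (Fin N)} (hη : η.Nonempty) (hb : Bornology.IsBounded (face M.nodes η))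
    (hne : (face M.nodes η).Nonempty) : M.faceVertices η ≠ [] := by
  obtain ⟨σ, r, hσ, hησ⟩ := exists_isVertex hX hη hb hne
  exact List.ne_nil_of_mem ((mem_faceVertices hM (v := (σ, r))).2 ⟨hσ, hησ⟩)

theorem faceVertices_eq_nil (hM : M.IsComplete) {η : Finset (Fin N)}
    (he : face M.nodes η = ∅) : M.faceVertices η = [] := by
  rw [List.eq_nil_iff_forall_not_mem]
  intro v hv
  obtain ⟨hv, hηv⟩ := (mem_faceVertices hM).1 hv
  have := hv.mem_face.2 hηv
  rw [he] at this
  exact this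

theorem apply_midpoint (a : Pt d →ᵃ[ℝ] ℝ) {V : List (Finset (Fin N) × Pt d)} (hV : V ≠ []) :
    a (midpoint V) = (V.length : ℝ)⁻¹ * (V.map fun v => a v.2).sum := by
  have key : ∀ V : List (Finset (Fin N) × Pt d),
      a.linear (V.map Prod.snd).sum + V.length * a 0 = (V.map fun v => a v.2).sum := by
    intro V
    induction V with
    | nil => simp
    | cons v V ih =>
      have : a v.2 = a.linear v.2 + a 0 := congrFun (AffineMap.decomp a) v.2
      simp only [List.map_cons, List.sum_cons, map_add, List.length_cons, Nat.cast_add,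
        Nat.cast_one, ← ih, this]
      ring
  have hlen : (V.length : ℝ) ≠ 0 := by simpa using hV
  have : a (midpoint V) = a.linear (midpoint V) + a 0 := congrFun (AffineMap.decomp a) _
  rw [this, ← key, midpoint, map_smul, smul_eq_mul]
  field_simp

/-- The gap of `k` at the midpoint is the mean of nonnegative gaps at the vertices. For `k ∉ η` one
of these is positive by `exists_isVertex_notMem`, so the midpoint is a relative interior point. -/
theorem nearest_midpoint (hX : GeneralPosition M.nodes) (hM : M.IsComplete)
    {η : Finset (Fin N)} (hη : η.Nonempty) (hb : Bornology.IsBounded (face M.nodes η))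
    (hne : (face M.nodes η).Nonempty) : nearest M.nodes (midpoint (M.faceVertices η)) = η := by
  obtain ⟨i, hi⟩ := hη
  have hV := faceVertices_ne_nil hX hM ⟨i, hi⟩ hb hne
  have hlen : 0 < ((M.faceVertices η).length : ℝ) := by
    simpa using List.length_pos_iff.2 hV
  have hin : ∀ v ∈ M.faceVertices η, i ∈ nearest M.nodes v.2 := fun v hv =>
    ((mem_faceVertices hM).1 hv).1.mem_iff.1 (((mem_faceVertices hM).1 hv).2 hi)
  have hnonneg : ∀ k, ∀ q ∈ (M.faceVertices η).map fun v => gap M.nodes i k v.2, 0 ≤ q := by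
    intro k q hq
    obtain ⟨v, hv, rfl⟩ := List.mem_map.1 hq
    exact mem_cell_iff.1 (show v.2 ∈ cell M.nodes i from hin v hv) k
  have hmem : midpoint (M.faceVertices η) ∈ face M.nodes η := by
    refine (mem_face_iff hi).2 ⟨fun k => ?_, fun k hk => ?_⟩
    · rw [apply_midpoint _ hV]
      exact mul_nonneg (inv_nonneg.2 hlen.le) (List.sum_nonneg (hnonneg k))
    · rw [apply_midpoint _ hV, List.sum_eq_zero, mul_zero]
      intro q hq
      obtain ⟨v, hv, rfl⟩ := List.mem_map.1 hq
      have := (mem_faceVertices hM).1 hv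
      exact (mem_nearest_iff (hin v hv)).1 (this.1.mem_iff.1 (this.2 hk))
  refine Set.Subset.antisymm (fun k hk => ?_) (mem_face_iff_subset_nearest.1 hmem)
  by_contra hkη
  obtain ⟨σ, r, hσ, hησ, hkσ⟩ := exists_isVertex_notMem hX ⟨i, hi⟩ hb hne hkη
  have h0 := (mem_nearest_iff (hmem i hi)).1 hk
  rw [apply_midpoint _ hV] at h0
  have h1 : gap M.nodes i k r ≤ ((M.faceVertices η).map fun v => gap M.nodes i k v.2).sum :=
    List.single_le_sum (hnonneg k) _ (List.mem_map.2
      ⟨(σ, r), (mem_faceVertices hM).2 ⟨hσ, hησ⟩, rfl⟩)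
  have h2 := gap_pos (hσ.mem_iff.1 (hησ hi)) fun h => hkσ (hσ.mem_iff.2 h)
  have := mul_pos (inv_pos.2 hlen) (h2.trans_le h1)
  linarith

/-- A second list entry exists because some vertex lacks a given extra generator of the first. Thus
the two entries read by the algorithm are the ends of the edge. -/
theorem exists_faceVertices_edge (hX : GeneralPosition M.nodes) (hM : M.IsComplete) (hd : 1 ≤ d)
    {η : Finset (Fin N)} (hη : η.card = d) (hb : Bornology.IsBounded (face M.nodes η))
    (hne : (face M.nodes η).Nonempty) :
    ∃ v w l, M.faceVertices η = v :: w :: l ∧ v ≠ w ∧ face M.nodes η = segment ℝ v.2 w.2 := by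
  have hηne : η.Nonempty := Finset.card_pos.1 (by omega)
  obtain ⟨v, l, hvl⟩ := List.exists_cons_of_ne_nil (faceVertices_ne_nil hX hM hηne hb hne)
  have hv := (mem_faceVertices hM).1 (hvl ▸ List.mem_cons_self : v ∈ M.faceVertices η)
  obtain ⟨a, ha, haη⟩ : ∃ a ∈ v.1, a ∉ η := by
    by_contra! h
    have := Finset.card_le_card h
    rw [hv.1.2.1] at this
    omega
  obtain ⟨σ, r, hσ, hησ, haσ⟩ := exists_isVertex_notMem hX hηne hb hne haη
  have hr : (σ, r) ∈ M.faceVertices η := (mem_faceVertices hM).2 ⟨hσ, hησ⟩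
  have hrl : (σ, r) ∈ l := by
    rw [hvl] at hr
    rcases List.mem_cons.1 hr with h | h
    · rw [← h] at ha; exact absurd ha haσ
    · exact h
  obtain ⟨w, l', rfl⟩ := List.exists_cons_of_ne_nil (List.ne_nil_of_mem hrl)
  have hw := (mem_faceVertices hM).1
    (hvl ▸ List.mem_cons_of_mem _ List.mem_cons_self : w ∈ M.faceVertices η)
  have hvw : v ≠ w := by
    have := hM.nodup.filter (fun v => decide (η ⊆ v.1))
    rw [← Mesh.faceVertices, hvl] at this
    exact fun h => (List.nodup_cons.1 this).1 (h ▸ List.mem_cons_self)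
  refine ⟨v, w, l', hvl, hvw, edge_eq_segment hd hη hv.1 hw.1 hv.2 hw.2 fun h => ?_⟩
  refine hvw (Prod.ext ?_ h)
  have := hv.1
  rw [h] at this
  exact (this.inj_left hw.1).symm

theorem IsFaceSimplex.ne_nil {η : Finset (Fin N)} {L : List (Pt d)} (h : IsFaceSimplex M η L) :
    L ≠ [] := by
  cases h <;> simp

theorem IsFaceSimplex.subset_face (hX : GeneralPosition M.nodes) (hM : M.IsComplete)
    {η : Finset (Fin N)} {L : List (Pt d)} (h : IsFaceSimplex M η L) (hη : η.Nonempty)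
    (hb : Bornology.IsBounded (face M.nodes η)) : ∀ p ∈ L, p ∈ face M.nodes η := by
  induction h with
  | edge η v w hη hv hw hvw =>
    intro p hp
    rcases List.mem_cons.1 hp with rfl | hp
    · exact ((mem_faceVertices hM).1 hv).1.mem_face.2 ((mem_faceVertices hM).1 hv).2
    · rw [List.mem_singleton.1 hp]
      exact ((mem_faceVertices hM).1 hw).1.mem_face.2 ((mem_faceVertices hM).1 hw).2
  | cone η j L hηd hj hL ih =>
    have hsub : face M.nodes (insert j η) ⊆ face M.nodes η := face_anti (Finset.subset_insert _ _)
    have ih' := ih (Finset.insert_nonempty _ _) (hb.subset hsub)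
    intro p hp
    rcases List.mem_cons.1 hp with rfl | hp
    · obtain ⟨q, hq⟩ := List.exists_mem_of_ne_nil _ hL.ne_nil
      exact mem_face_iff_subset_nearest.2 (nearest_midpoint hX hM hη hb ⟨q, hsub (ih' q hq)⟩).ge
    · exact hsub (ih' p hp)

theorem IsFaceSimplex.convexHull_subset_face (hX : GeneralPosition M.nodes) (hM : M.IsComplete)
    {η : Finset (Fin N)} {L : List (Pt d)} (h : IsFaceSimplex M η L) (hη : η.Nonempty)
    (hb : Bornology.IsBounded (face M.nodes η)) :
    convexHull ℝ {p | p ∈ L} ⊆ face M.nodes η :=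
  convexHull_min (h.subset_face hX hM hη hb) (convex_face η)

theorem convexHull_cons (m : Pt d) {L : List (Pt d)} (hL : L ≠ []) :
    convexHull ℝ {p | p ∈ m :: L} = join m (convexHull ℝ {p | p ∈ L}) := by
  rw [join_convexHull m (s := {p | p ∈ L}) (List.exists_mem_of_ne_nil _ hL)]
  congr 1
  ext q
  simp

theorem segment_eq_convexHull_list (v w : Pt d) :
    segment ℝ v w = convexHull ℝ {p | p ∈ [v, w]} := by
  rw [← convexHull_pair]
  congr 1
  ext q
  simp

/-- A function which is affine on the simplices is integrable. -/
theorem integrableOn_joins_face (hX : GeneralPosition M.nodes) (hM : M.IsComplete)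
    (ν : Measure (Pt d)) (F : Pt d → ℝ) (n : ℕ) (hn : 1 ≤ n) (η : Finset (Fin N))
    (P : List (Pt d)) (hη : η.Nonempty) (hcard : η.card + n = d + 1)
    (hb : Bornology.IsBounded (face M.nodes η)) (hν : ν (joins P (face M.nodes η)) ≠ ⊤)
    (hF : ∀ L, IsFaceSimplex M η L → ∃ a : Pt d →ᵃ[ℝ] ℝ,
      ∀ y ∈ joins P (convexHull ℝ {p | p ∈ L}), F y = a y) :
    IntegrableOn F (joins P (face M.nodes η)) ν := by
  induction n, hn using Nat.le_induction generalizing η P with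
  | base =>
    rcases (face M.nodes η).eq_empty_or_nonempty with he | hne
    · rw [he, joins_empty]; exact integrableOn_empty
    have hpos := Finset.card_pos.2 hη
    obtain ⟨v, w, l, hV, hvw, hseg⟩ := exists_faceVertices_edge hX hM (by omega) (by omega) hb hne
    obtain ⟨a, ha⟩ := hF _ (IsFaceSimplex.edge η v w (by omega) (by simp [hV]) (by simp [hV]) hvw)
    rw [← segment_eq_convexHull_list, ← hseg] at ha
    have hK := isCompact_joins P (isCompact_face hb)
    -- The area measure is not finite on all compact sets of `ℝ^d`, so continuity is exploited for
    -- the restricted measure.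
    have hfin : IsFiniteMeasure (ν.restrict (joins P (face M.nodes η))) :=
      ⟨by rw [Measure.restrict_apply_univ]; exact hν.lt_top⟩
    have h1 : IntegrableOn a (joins P (face M.nodes η))
        (ν.restrict (joins P (face M.nodes η))) :=
      (AffineMap.continuous_of_finiteDimensional a).continuousOn.integrableOn_compact hK
    rw [IntegrableOn, Measure.restrict_restrict hK.measurableSet, Set.inter_self] at h1
    exact IntegrableOn.congr_fun h1 (fun y hy => (ha y hy).symm) hK.measurableSet
  | succ n hn ih =>
    rcases (face M.nodes η).eq_empty_or_nonempty with he | hne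
    · rw [he, joins_empty]; exact integrableOn_empty
    have hm := nearest_midpoint hX hM hη hb hne
    rw [joins_face_eq_iUnion hX P hη (by omega) hb hm] at hν ⊢
    refine integrableOn_finite_iUnion.2 fun j => ih _ _ (Finset.insert_nonempty _ _)
      (by rw [Finset.card_insert_of_notMem j.2]; omega)
      (hb.subset (face_anti (Finset.subset_insert _ _)))
      (measure_ne_top_of_subset (Set.subset_iUnion (fun j : {j // j ∉ η} =>
        joins (midpoint (M.faceVertices η) :: P) (face M.nodes (insert j.1 η))) j) hν)
      fun L hL => ?_
    obtain ⟨a, ha⟩ := hF _ (IsFaceSimplex.cone η j L (by omega) j.2 hL)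
    rw [convexHull_cons _ hL.ne_nil] at ha
    exact ⟨a, ha⟩

/-! ### The recursion computes the integrals -/

/-- The set `N₀` may contain indices whose facet is empty; their terms contribute nothing. -/
theorem iterativeVolume_nil (c : Pt d) (f : Pt d → ℝ) (n : ℕ) (N₀ : Finset (Fin N))
    (A : Minors d) : iterativeVolume c f n [] N₀ A = (0, 0) := by
  induction n using Nat.strong_induction_on generalizing N₀ A with
  | _ n ih =>
    match n with
    | 0 => rfl
    | 1 => rfl
    | n + 2 =>
      have : ∀ j ∈ N₀, ∀ A', iterativeVolume c f (n + 1) (having j ([] : List (Finset (Fin N) × _)))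
          (N₀.erase j) A' = 0 := fun j _ A' => ih (n + 1) (by omega) _ _
      simp only [iterativeVolume]
      rw [Finset.sum_eq_zero fun j hj => this j hj _]
      simp

/-- The weights `n / (n + 1)` and `1 / (n + 1)` sum to `1`. This makes every volume statement the
case `f = 1` of an integral. -/
theorem iterativeVolume_one (c : Pt d) (f : Pt d → ℝ) (n : ℕ)
    (V : List (Finset (Fin N) × Pt d)) (N₀ : Finset (Fin N)) (A : Minors d) :
    iterativeVolume c (fun _ => 1) n V N₀ A =
      ((iterativeVolume c f n V N₀ A).1, (iterativeVolume c f n V N₀ A).1) := by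
  induction n using Nat.strong_induction_on generalizing V N₀ A with
  | _ n ih =>
    match n with
    | 0 => rfl
    | 1 =>
      match V with
      | [] => rfl
      | [v] => rfl
      | v :: w :: l => simp only [iterativeVolume]; norm_num
    | n + 2 =>
      simp only [iterativeVolume]
      have h : (∑ j ∈ N₀, iterativeVolume c (fun _ => 1) (n + 1) (having j V) (N₀.erase j)
          (updateMinors A (midpoint V - c) (n + 3))) =
          (∑ j ∈ N₀, (iterativeVolume c f (n + 1) (having j V) (N₀.erase j)
            (updateMinors A (midpoint V - c) (n + 3))).1,
          ∑ j ∈ N₀, (iterativeVolume c f (n + 1) (having j V) (N₀.erase j)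
            (updateMinors A (midpoint V - c) (n + 3))).1) := by
        rw [Finset.sum_congr rfl fun j _ => ih (n + 1) (by omega) _ _ _]
        ext <;> simp [Prod.fst_sum, Prod.snd_sum]
      rw [h, Prod.fst_sum]
      ext
      · rfl
      · simp only
        have : (n : ℝ) + 3 ≠ 0 := by positivity
        field_simp
        ring

theorem exists_eq_ofFn {α : Type*} {n : ℕ} (l : List α) (h : l.length = n) :
    ∃ w : Fin n → α, l = List.ofFn w := by
  subst h
  exact ⟨l.get, (List.ofFn_get l).symm⟩

theorem setIntegral_joins_segment {F f : Pt d → ℝ} {c v w : Pt d} {P : List (Pt d)} {s : ℝ}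
    {A : Minors d} (hlen : P.length + 2 = d) (hA : A.Stores 3 (P.map (· - c)))
    {a : Pt d →ᵃ[ℝ] ℝ} (hs : ((P ++ [c]).map a).sum = s) (hv : a v = f v) (hw : a w = f w)
    (hF : ∀ y ∈ joins (P ++ [c]) (segment ℝ v w), F y = a y) :
    ∫ y in joins (P ++ [c]) (segment ℝ v w), F y =
      |(updateMinors (updateMinors A (v - c) 2) (w - c) 1).det| / d.factorial *
        ((f v + f w + s) / (d + 1)) := by
  have hK : IsCompact (joins (P ++ [c]) (segment ℝ v w)) := by
    rw [← convexHull_pair]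
    exact isCompact_joins _ (Set.Finite.isCompact_convexHull ℝ (Set.toFinite _))
  rw [setIntegral_congr_fun hK.measurableSet hF]
  -- The columns in the order of their levels: `w` at level `1`, `v` at level `2`, then the
  -- midpoints, the most recent first.
  obtain ⟨q, hq⟩ := exists_eq_ofFn (w :: v :: P) (n := d) (by simp [← hlen])
  have hrange : joins (P ++ [c]) (segment ℝ v w) =
      convexHull ℝ (Set.range (Fin.cons c q : Fin (d + 1) → Pt d)) := by
    rw [← convexHull_pair, joins_convexHull _ (Set.insert_nonempty _ _), Fin.range_cons]
    congr 1
    have hr : ∀ p, p ∈ Set.range q ↔ p ∈ w :: v :: P := fun p => by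
      rw [hq, List.mem_ofFn, Set.mem_range]
    ext p
    simp only [Set.mem_union, Set.mem_ofPred_eq, Set.mem_insert_iff, Set.mem_singleton_iff, hr,
      List.mem_append, List.mem_cons, List.not_mem_nil, or_false]
    tauto
  have hst : (updateMinors (updateMinors A (v - c) 2) (w - c) 1).Stores 1
      (List.ofFn fun k => q k - c) := by
    have h1 := (hA.update (by simpa using hlen) (v - c)).update
      (by simp; omega) (w - c)
    have h2 : (List.ofFn fun k => q k - c) = (w - c) :: (v - c) :: P.map (· - c) := by
      have := congrArg (List.map (· - c)) hq
      rw [List.map_ofFn] at this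
      simpa [Function.comp_def] using this.symm
    rw [h2]; exact h1
  rw [hrange, setIntegral_affine_convexHull,
    hst.det_eq (by omega) (by simp) _ rfl, Fin.sum_univ_succ]
  have hsum : ∑ k, a (q k) = a w + (a v + (P.map a).sum) := by
    have := congrArg (fun l => (List.map a l).sum) hq
    simp only [List.map_ofFn, List.sum_ofFn, List.map_cons, List.sum_cons] at this
    exact this.symm
  simp only [Fin.cons_zero, Fin.cons_succ, hsum]
  rw [List.map_append, List.sum_append] at hs
  simp only [List.map_cons, List.map_nil, List.sum_cons, List.sum_nil] at hs
  rw [← hs, hv, hw]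
  ring

/-- The loop invariant. `P` holds the midpoints passed on the way down, the latest first, and `s` is
the sum of the values at these and at `c`. Of the `d + 1` corner values to be averaged, `n + 1`
belong to the current face and are averaged in the second output; the rest are collected in `s`.
Descending moves `f m` from the face to `s`. -/
theorem setIntegral_joins_face_eq (hX : GeneralPosition M.nodes) (hM : M.IsComplete)
    {F f : Pt d → ℝ} {c : Pt d} (n : ℕ) (hn : 1 ≤ n) (η : Finset (Fin N)) (P : List (Pt d))
    (N₀ : Finset (Fin N)) (A : Minors d) (s : ℝ)
    (hη : η.Nonempty) (hcard : η.card + n = d + 1)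
    (hb : Bornology.IsBounded (face M.nodes η))
    (hN : ∀ j ∉ η, (face M.nodes (insert j η)).Nonempty → j ∈ N₀) (hN' : ∀ j ∈ N₀, j ∉ η)
    (hP : AffineExtendable (P ++ [c]) (face M.nodes η)) (hlen : P.length + (n + 1) = d)
    (hA : A.Stores (n + 2) (P.map (· - c)))
    (hF : ∀ L, IsFaceSimplex M η L → ∃ a : Pt d →ᵃ[ℝ] ℝ, ((P ++ [c]).map a).sum = s ∧
      (∀ p ∈ L, a p = f p) ∧ ∀ y ∈ joins (P ++ [c]) (convexHull ℝ {p | p ∈ L}), F y = a y) :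
    ∫ y in joins (P ++ [c]) (face M.nodes η), F y =
      ((n + 1) / (d + 1) * (iterativeVolume c f n (M.faceVertices η) N₀ A).2 +
        s / (d + 1) * (iterativeVolume c f n (M.faceVertices η) N₀ A).1) / d.factorial := by
  induction n, hn using Nat.le_induction generalizing η P N₀ A s with
  | base =>
    rcases (face M.nodes η).eq_empty_or_nonempty with he | hne
    · rw [faceVertices_eq_nil hM he, he, joins_empty, iterativeVolume_nil]; simp
    obtain ⟨v, w, l, hV, hvw, hseg⟩ := exists_faceVertices_edge hX hM (by omega) (by omega) hb hne
    obtain ⟨a, hs, haL, ha⟩ := hF _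
      (IsFaceSimplex.edge η v w (by omega) (by simp [hV]) (by simp [hV]) hvw)
    rw [← segment_eq_convexHull_list] at ha
    rw [hseg, setIntegral_joins_segment (by omega) hA hs (haL _ (by simp)) (haL _ (by simp)) ha,
      hV]
    simp only [iterativeVolume]
    push_cast
    ring
  | succ n hn ih =>
    rcases (face M.nodes η).eq_empty_or_nonempty with he | hne
    · rw [faceVertices_eq_nil hM he, he, joins_empty, iterativeVolume_nil]; simp
    obtain ⟨n, rfl⟩ : ∃ k, n = k + 1 := ⟨n - 1, by omega⟩
    have hm := nearest_midpoint hX hM hη hb hne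
    set m := midpoint (M.faceVertices η) with hmdef
    have hint : IntegrableOn F (joins (P ++ [c]) (face M.nodes η)) :=
      integrableOn_joins_face hX hM volume F (n + 1 + 1) (by omega) η (P ++ [c]) hη hcard hb
        (isCompact_joins _ (isCompact_face hb)).measure_lt_top.ne fun L hL =>
          (hF L hL).imp fun a ha => ha.2.2
    rw [setIntegral_joins_face hX hη (by omega) hb hm hP hint]
    have hsub : N₀ ⊆ ηᶜ := fun j hj => Finset.mem_compl.2 (hN' j hj)
    -- A facet whose index is missing from `N₀` is empty, so summing over `N₀` loses nothing.
    rw [← Finset.sum_subset hsub fun j hj hjN => by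
      have he : face M.nodes (insert j η) = ∅ :=
        Set.not_nonempty_iff_eq_empty.1 fun h => hjN (hN j (Finset.mem_compl.1 hj) h)
      rw [he, joins_empty]; simp]
    have hterm : ∀ j ∈ N₀, ∫ y in joins (m :: (P ++ [c])) (face M.nodes (insert j η)), F y =
        (((n + 1 : ℕ) + 1) / (d + 1) * (iterativeVolume c f (n + 1)
            (having j (M.faceVertices η)) (N₀.erase j) (updateMinors A (m - c) (n + 3))).2 +
          (f m + s) / (d + 1) * (iterativeVolume c f (n + 1)
            (having j (M.faceVertices η)) (N₀.erase j) (updateMinors A (m - c) (n + 3))).1) /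
          d.factorial := by
      intro j hj
      have hjη := hN' j hj
      rw [having_faceVertices]
      refine ih (insert j η) (m :: P) (N₀.erase j) _ (f m + s) (Finset.insert_nonempty _ _)
        (by rw [Finset.card_insert_of_notMem hjη]; omega)
        (hb.subset (face_anti (Finset.subset_insert _ _))) ?_ ?_ (hP.facet hη hm hjη)
        (by simp; omega) (hA.update (by simp; omega) (m - c)) ?_
      · intro k hk hkne
        rw [Finset.mem_insert, not_or] at hk
        refine Finset.mem_erase.2 ⟨hk.1, hN k hk.2 (hkne.mono (face_anti ?_))⟩
        exact Finset.insert_subset_insert _ (Finset.subset_insert _ _)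
      · intro k hk
        rw [Finset.mem_erase] at hk
        simp [hk.1, hN' k hk.2]
      · intro L hL
        obtain ⟨a, hs, haL, ha⟩ := hF _ (IsFaceSimplex.cone η j L (by omega) hjη hL)
        rw [convexHull_cons _ hL.ne_nil] at ha
        refine ⟨a, ?_, fun p hp => haL p (List.mem_cons_of_mem _ hp), ha⟩
        rw [List.cons_append, List.map_cons, List.sum_cons, hs, haL _ List.mem_cons_self]
    rw [Finset.sum_congr rfl hterm]
    simp only [iterativeVolume, ← hmdef, Prod.fst_sum, Prod.snd_sum]
    rw [← Finset.sum_div, Finset.sum_add_distrib, ← Finset.mul_sum, ← Finset.mul_sum]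
    congr 1
    have h3 : (n : ℝ) + 3 ≠ 0 := by positivity
    push_cast
    field_simp
    ring

/-! ### Interfaces -/

theorem nearest_node (hx : Function.Injective x) (i : Fin N) : nearest x (x i) = {i} := by
  ext k
  simp only [nearest, Set.mem_ofPred_eq, Set.mem_singleton_iff]
  constructor
  · intro h
    have := h i
    rw [dist_self] at this
    exact (hx (dist_le_zero.1 this)).symm
  · rintro rfl l
    rw [dist_self]; exact dist_nonneg

/-- The unit normal of the interface of the cells `i` and `j`. -/
def normal (x : Fin N → Pt d) (i j : Fin N) : Pt d := ‖x j - x i‖⁻¹ • (x j - x i)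

theorem norm_normal (hx : Function.Injective x) {i j : Fin N} (hij : i ≠ j) :
    ‖normal x i j‖ = 1 := by
  have : ‖x j - x i‖ ≠ 0 := norm_ne_zero_iff.2 (sub_ne_zero.2 fun h => hij (hx h).symm)
  rw [normal, norm_smul, norm_inv, norm_norm, inv_mul_cancel₀ this]

theorem inner_normal (hx : Function.Injective x) {i j : Fin N} (hij : i ≠ j) {y : Pt d}
    (hy : gap x i j y = 0) : inner ℝ (normal x i j) (y - x i) = ‖x j - x i‖ / 2 := by
  have hne : ‖x j - x i‖ ≠ 0 := norm_ne_zero_iff.2 (sub_ne_zero.2 fun h => hij (hx h).symm)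
  have h1 : ‖x j‖ ^ 2 - ‖x i‖ ^ 2 = ‖x j - x i‖ ^ 2 + 2 * inner ℝ (x j - x i) (x i) := by
    have := norm_add_sq_real (x j - x i) (x i)
    rw [sub_add_cancel] at this
    linarith
  rw [gap_apply'] at hy
  rw [normal, inner_smul_left, inner_sub_right]
  simp only [RCLike.conj_to_real]
  field_simp
  linarith

theorem gap_eq_zero_of_mem_face_pair {i j : Fin N} {y : Pt d} (hy : y ∈ face x {i, j}) :
    gap x i j y = 0 :=
  ((mem_face_iff (by simp)).1 hy).2 j (by simp)

theorem face_pair_eq_insert (i j : Fin N) : face x {i, j} = face x (insert j {i}) := by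
  rw [Finset.pair_comm]

theorem facetCoord_node_self (hx : Function.Injective x) {i j : Fin N} (hij : i ≠ j) :
    facetCoord x i j (x i) (x i) = 1 :=
  facetCoord_apex (η := {i}) (by rw [nearest_node hx]; simp) (by simp) (by simpa using hij.symm)

theorem facetCoord_node_face {i j : Fin N} {z : Pt d}
    (hz : z ∈ face x {i, j}) : facetCoord x i j (x i) z = 0 :=
  facetCoord_eq_zero (η := {i}) (by simp) (face_pair_eq_insert (x := x) i j ▸ hz)

/-- The result of the recursion for the pyramid with apex `x_i` over the interface with the cell
`j`, without the factor `1 / d!`. -/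
def pyramid (M : Mesh d N) (f : Pt d → ℝ) (i j : Fin N) : ℝ × ℝ :=
  iterativeVolume (M.nodes i) f (d - 1) (M.faceVertices {i, j}) ((M.neighbors i).erase j)
    (Minors.init d)

theorem mem_neighbors (hM : M.IsComplete) {i j : Fin N} :
    j ∈ M.neighbors i ↔ j ≠ i ∧ M.faceVertices {i, j} ≠ [] := by
  simp only [Mesh.neighbors, Finset.mem_filter, Finset.mem_univ, true_and]
  refine and_congr_right fun _ => ⟨?_, fun h => ?_⟩
  · rintro ⟨v, hv, hi, hj⟩
    refine List.ne_nil_of_mem (a := v) ((mem_faceVertices hM).2 ⟨(hM.mem_vertices _ _).1 hv, ?_⟩)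
    simp [Finset.insert_subset_iff, hi, hj]
  · obtain ⟨v, hv⟩ := List.exists_mem_of_ne_nil _ h
    have h' := (mem_faceVertices hM).1 hv
    exact ⟨v, (hM.mem_vertices _ _).2 h'.1, h'.2 (by simp), h'.2 (by simp)⟩

/-- The value `s` at the apex is left free: it is `f (x_i)` for the cell integral, `1` for the
volume and `0` for the area integral. Only the interface has to be bounded. -/
theorem setIntegral_pyramid (hd : 2 ≤ d) (hX : GeneralPosition M.nodes) (hM : M.IsComplete)
    {F f : Pt d → ℝ} {i j : Fin N} (hij : i ≠ j) (s : ℝ)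
    (hb : Bornology.IsBounded (face M.nodes {i, j}))
    (hF : ∀ L, IsFaceSimplex M {i, j} L → ∃ a : Pt d →ᵃ[ℝ] ℝ, a (M.nodes i) = s ∧
      (∀ p ∈ L, a p = f p) ∧
      ∀ y ∈ join (M.nodes i) (convexHull ℝ {p | p ∈ L}), F y = a y) :
    IntegrableOn F (join (M.nodes i) (face M.nodes {i, j})) ∧
    ∫ y in join (M.nodes i) (face M.nodes {i, j}), F y =
      (d / (d + 1) * (pyramid M f i j).2 + s / (d + 1) * (pyramid M f i j).1) / d.factorial := by
  have hη : ({i, j} : Finset (Fin N)).Nonempty := ⟨i, by simp⟩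
  have hcard : ({i, j} : Finset (Fin N)).card + (d - 1) = d + 1 := by
    rw [Finset.card_pair hij]; omega
  constructor
  · exact integrableOn_joins_face hX hM volume F (d - 1) (by omega) _ [M.nodes i] hη hcard hb
      (isCompact_joins _ (isCompact_face hb)).measure_lt_top.ne fun L hL =>
        (hF L hL).imp fun a ha => ha.2.2
  · have hN : ∀ k ∉ ({i, j} : Finset (Fin N)), (face M.nodes (insert k {i, j})).Nonempty →
        k ∈ (M.neighbors i).erase j := by
      intro k hk hne
      simp only [Finset.mem_insert, Finset.mem_singleton, not_or] at hk
      refine Finset.mem_erase.2 ⟨hk.2, (mem_neighbors hM).2 ⟨hk.1, ?_⟩⟩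
      obtain ⟨σ, r, hσ, hησ⟩ := exists_isVertex hX (Finset.insert_nonempty k {i, j})
        (hb.subset (face_anti (Finset.subset_insert _ _))) hne
      refine List.ne_nil_of_mem (a := (σ, r)) ((mem_faceVertices hM).2 ⟨hσ, ?_⟩)
      exact Finset.insert_subset (hησ (by simp)) (by simpa using hησ (by simp))
    have hN' : ∀ k ∈ (M.neighbors i).erase j, k ∉ ({i, j} : Finset (Fin N)) := by
      intro k hk
      rw [Finset.mem_erase] at hk
      simp [hk.1, ((mem_neighbors hM).1 hk.2).1]
    have hP : AffineExtendable [M.nodes i] (face M.nodes {i, j}) := by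
      rw [face_pair_eq_insert]
      exact (affineExtendable_nil _).facet (Finset.singleton_nonempty i)
        (by rw [nearest_node hX.1]; simp) (by simpa using hij.symm)
    have h := setIntegral_joins_face_eq hX hM (F := F) (f := f) (c := M.nodes i) (d - 1)
      (by omega) {i, j} [] _ (Minors.init d) s hη hcard hb hN hN' hP (by simp; omega)
      -- The starting level is `d + 1`, where `Minors.Stores` demands nothing, so the zero data set
      -- qualifies.
      (fun τ _ hk => by omega) (fun L hL => by
        obtain ⟨a, h1, h2, h3⟩ := hF L hL
        exact ⟨a, by simpa using h1, h2, h3⟩)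
    have hcast : ((d - 1 : ℕ) : ℝ) + 1 = d := by
      rw [Nat.cast_sub (by omega)]; simp
    rw [hcast] at h
    exact h

theorem volume_pyramid (hd : 2 ≤ d) (hX : GeneralPosition M.nodes) (hM : M.IsComplete)
    (f : Pt d → ℝ) {i j : Fin N} (hij : i ≠ j)
    (hb : Bornology.IsBounded (face M.nodes {i, j})) :
    volume.real (join (M.nodes i) (face M.nodes {i, j})) =
      (pyramid M f i j).1 / d.factorial := by
  have h := (setIntegral_pyramid hd hX hM (F := fun _ => 1) (f := fun _ => 1) hij 1 hb
    fun L _ => ⟨AffineMap.const ℝ _ 1, rfl, fun _ _ => rfl, fun _ _ => rfl⟩).2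
  rw [setIntegral_const, smul_eq_mul, mul_one, pyramid, iterativeVolume_one _ f] at h
  rw [h, pyramid]
  have : (d : ℝ) + 1 ≠ 0 := by positivity
  field_simp

theorem hausdorff_face_pair_ne_top (hX : GeneralPosition M.nodes) {i j : Fin N} (hij : i ≠ j)
    (hb : Bornology.IsBounded (face M.nodes {i, j})) :
    μHE[d - 1] (face M.nodes {i, j}) ≠ ⊤ :=
  hausdorff_slice_ne_top (norm_normal hX.1 hij) (isCompact_face hb) fun _ hy =>
    inner_normal hX.1 hij (gap_eq_zero_of_mem_face_pair hy)

theorem area_pyramid (hd : 2 ≤ d) (hX : GeneralPosition M.nodes) (hM : M.IsComplete)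
    (f : Pt d → ℝ) {i j : Fin N} (hij : i ≠ j)
    (hb : Bornology.IsBounded (face M.nodes {i, j})) :
    (pyramid M f i j).1 / d.factorial =
      ‖M.nodes j - M.nodes i‖ / 2 / d * (μHE[d - 1]).real (face M.nodes {i, j}) := by
  have hpos : 0 < ‖M.nodes j - M.nodes i‖ :=
    norm_pos_iff.2 (sub_ne_zero.2 fun h => hij (hX.1 h).symm)
  have hJ := isCompact_join (M.nodes i) (isCompact_face hb)
  have h := setIntegral_join_eq (by omega) (norm_normal hX.1 hij) (half_pos hpos)
    (isCompact_face hb).measurableSet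
    (fun y hy => inner_normal hX.1 hij (gap_eq_zero_of_mem_face_pair hy)) 0 (fun _ => 1)
    (fun _ => 1) (fun z _ t _ => by simp) hJ.measurableSet
    (continuous_const.continuousOn.integrableOn_compact hJ)
  rw [← volume_pyramid hd hX hM f hij hb]
  simpa using h

/-- The extension `G` of `F` from the interface, homogeneous of degree `1` about `x_i`, is
integrated over the pyramid twice. The recursion with apex value `0` gives the factor `d / (d + 1)`,
the cone formula with `p = 1` gives `h / (d + 1)`; their quotient is `h / d`. -/
theorem areaIntegral_pyramid (hd : 2 ≤ d) (hX : GeneralPosition M.nodes) (hM : M.IsComplete)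
    {F f : Pt d → ℝ} {i j : Fin N} (hij : i ≠ j)
    (hb : Bornology.IsBounded (face M.nodes {i, j}))
    (hF : ∀ L, IsFaceSimplex M {i, j} L → InterpolatesOn f F L) :
    IntegrableOn F (face M.nodes {i, j}) μHE[d - 1] ∧
    (pyramid M f i j).2 / d.factorial =
      ‖M.nodes j - M.nodes i‖ / 2 / d * ∫ y in face M.nodes {i, j}, F y ∂μHE[d - 1] := by
  have hη : ({i, j} : Finset (Fin N)).Nonempty := ⟨i, by simp⟩
  have hcard : ({i, j} : Finset (Fin N)).card + (d - 1) = d + 1 := by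
    rw [Finset.card_pair hij]; omega
  constructor
  · exact integrableOn_joins_face hX hM _ F (d - 1) (by omega) _ [] hη hcard hb
      (hausdorff_face_pair_ne_top hX hij hb) fun L hL => (hF L hL).imp fun a ha => ha.2
  · have hpos : 0 < ‖M.nodes j - M.nodes i‖ :=
      norm_pos_iff.2 (sub_ne_zero.2 fun h => hij (hX.1 h).symm)
    set c := M.nodes i with hc
    set q := facetCoord M.nodes i j c with hq
    have hqc : q c = 1 := facetCoord_node_self hX.1 hij
    have hqz : ∀ z ∈ face M.nodes {i, j}, q z = 0 := fun z hz => facetCoord_node_face hz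
    have hqt : ∀ z ∈ face M.nodes {i, j}, ∀ t : ℝ, 1 - q (AffineMap.lineMap c z t) = t := by
      intro z hz t
      rw [apply_lineMap, hqc, hqz z hz]; ring
    -- At `y = lineMap c z t` with `z` in the interface, `1 - q y = t`, and the inner `lineMap`
    -- recovers `z`. At the apex the factor `0` makes the value of the inverse irrelevant.
    set G : Pt d → ℝ := fun y => (1 - q y) * F (AffineMap.lineMap c y (1 - q y)⁻¹) with hG
    have hGz : ∀ z ∈ face M.nodes {i, j}, ∀ t : ℝ, G (AffineMap.lineMap c z t) = t * F z := by
      intro z hz t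
      simp only [hG, hqt z hz]
      rcases eq_or_ne t 0 with rfl | ht
      · simp
      · congr 2
        simp only [AffineMap.lineMap_apply_module]
        match_scalars <;> field_simp
        ring
    obtain ⟨hGint, hGval⟩ := setIntegral_pyramid hd hX hM (F := G) (f := f) hij 0 hb (by
      intro L hL
      obtain ⟨a, haL, ha⟩ := hF L hL
      have hsub := hL.convexHull_subset_face hX hM hη hb
      -- This agrees with `a` on the interface, where `q = 0`, and vanishes at `c`, where `q = 1`.
      refine ⟨a - a c • q, by simp [← hc, hqc], fun p hp => ?_, ?_⟩
      · simp [hqz p (hL.subset_face hX hM hη hb p hp), haL p hp]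
      · rintro _ ⟨t, ht, z, hz, rfl⟩
        rw [hGz z (hsub hz), ha z hz, apply_lineMap]
        simp [← hc, hqc, hqz z (hsub hz)])
    have hJ := isCompact_join c (isCompact_face hb)
    have h := setIntegral_join_eq (by omega) (norm_normal hX.1 hij) (half_pos hpos)
      (isCompact_face hb).measurableSet
      (fun y hy => inner_normal hX.1 hij (gap_eq_zero_of_mem_face_pair hy)) 1 F G
      (fun z hz t _ => by rw [pow_one]; exact hGz z hz t) hJ.measurableSet hGint
    rw [← hc] at hGval
    rw [hGval] at h
    have h1 : (d : ℝ) + 1 ≠ 0 := by positivity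
    have h2 : (d : ℝ) ≠ 0 := by have : d ≠ 0 := by omega
                                exact_mod_cast this
    have h3 : (d.factorial : ℝ) ≠ 0 := by exact_mod_cast d.factorial_ne_zero
    push_cast at h
    field_simp at h ⊢
    linarith

/-! ### The output of the algorithm -/

theorem infDist_perpBisector (p q : Pt d) :
    Metric.infDist p (AffineSubspace.perpBisector p q : Set (Pt d)) = ‖q - p‖ / 2 := by
  have hmem : _root_.midpoint ℝ p q ∈ (AffineSubspace.perpBisector p q : Set (Pt d)) :=
    AffineSubspace.midpoint_mem_perpBisector p q
  refine le_antisymm ?_ ?_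
  · refine (Metric.infDist_le_dist_of_mem hmem).trans_eq ?_
    rw [dist_left_midpoint, dist_comm, dist_eq_norm, Real.norm_ofNat]
    ring
  · refine (Metric.le_infDist ⟨_, hmem⟩).2 fun y hy => ?_
    have h1 := AffineSubspace.mem_perpBisector_iff_dist_eq.1 hy
    have h2 := dist_triangle_right p q y
    rw [dist_comm p q, dist_eq_norm q p, dist_comm q y, ← h1, dist_comm y p] at h2
    linarith

/-- The span contains the interface, being closed and convex, and from the midpoint one can move a
little within the interface in every direction of the bisector. Hence the two definitions of `h_j`
agree. -/
theorem affineSpan_faceVertices (hX : GeneralPosition M.nodes) (hM : M.IsComplete)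
    {i j : Fin N} (hb : Bornology.IsBounded (face M.nodes {i, j}))
    (hne : (face M.nodes {i, j}).Nonempty) :
    affineSpan ℝ {p : Pt d | ∃ v ∈ M.faceVertices {i, j}, v.2 = p} =
      AffineSubspace.perpBisector (M.nodes i) (M.nodes j) := by
  have hη : ({i, j} : Finset (Fin N)).Nonempty := ⟨i, by simp⟩
  have hi : i ∈ ({i, j} : Finset (Fin N)) := by simp
  have hbis : ∀ y, y ∈ AffineSubspace.perpBisector (M.nodes i) (M.nodes j) ↔
      gap M.nodes i j y = 0 := by
    intro y
    rw [AffineSubspace.mem_perpBisector_iff_dist_eq, gap_apply, sub_eq_zero,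
      sq_eq_sq₀ dist_nonneg dist_nonneg, eq_comm]
  refine le_antisymm (affineSpan_le.2 ?_) ?_
  · rintro _ ⟨v, hv, rfl⟩
    have h := (mem_faceVertices hM).1 hv
    exact (hbis _).2 (gap_eq_zero_of_mem_face_pair (h.1.mem_face.2 h.2))
  · set Q := affineSpan ℝ {p : Pt d | ∃ v ∈ M.faceVertices {i, j}, v.2 = p} with hQ
    have hsub : face M.nodes {i, j} ⊆ (Q : Set (Pt d)) :=
      face_subset_of_vertices hX hη hb Q.convex (AffineSubspace.closed_of_finiteDimensional Q)
        fun σ r hσ hησ => subset_affineSpan ℝ _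
          ⟨(σ, r), (mem_faceVertices hM).2 ⟨hσ, hησ⟩, rfl⟩
    intro y hy
    have hm := nearest_midpoint hX hM hη hb hne
    set m := midpoint (M.faceVertices {i, j}) with hmdef
    have hmf : m ∈ face M.nodes {i, j} := mem_face_iff_subset_nearest.2 hm.ge
    have hu : ∀ k ∈ ({i, j} : Finset (Fin N)), inner ℝ (M.nodes k - M.nodes i) (y - m) = 0 := by
      intro k hk
      have h1 : gap M.nodes i k m = 0 := ((mem_face_iff hi).1 hmf).2 k hk
      have h2 : gap M.nodes i k y = 0 := by
        rcases Finset.mem_insert.1 hk with rfl | hk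
        · simp [gap_apply]
        · rw [Finset.mem_singleton.1 hk]; exact (hbis y).1 hy
      rw [gap_apply'] at h1 h2
      rw [inner_sub_right]; linarith
    obtain ⟨ε, hε, hmem⟩ := exists_add_smul_mem_face hi hmf hu fun k hk =>
      (hu k (by rw [hm] at hk; exact hk)).le
    have := AffineMap.lineMap_mem (Q := Q) ε⁻¹ (hsub hmf) (hsub hmem)
    convert this using 1
    simp only [AffineMap.lineMap_apply_module]
    match_scalars <;> field_simp
    ring

/-- Only records of cells `j < i` are read. Since later updates do not change these, the final table
satisfies its own recursion. -/
theorem integrateCell_congr (i : Fin N) (M : Mesh d N) (f : Pt d → ℝ) {T T' : Fin N → CellData N}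
    (h : ∀ j < i, T j = T' j) : integrateCell i M f T = integrateCell i M f T' := by
  have h1 : ∀ (g : Fin N → ℝ) (φ : CellData N → ℝ),
      ∑ j ∈ (M.neighbors i).filter (fun j => j < i), g j * φ (T j) =
        ∑ j ∈ (M.neighbors i).filter (fun j => j < i), g j * φ (T' j) :=
    fun g φ => Finset.sum_congr rfl fun j hj => by rw [h j (Finset.mem_filter.1 hj).2]
  have h2 : ∀ (p q : Fin N → ℝ) (φ : CellData N → ℝ) (s : Finset (Fin N)),
      (fun j => if j ∈ s then p j else
        if j ∈ (M.neighbors i).filter (fun j => j < i) then φ (T j) else q j) =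
      fun j => if j ∈ s then p j else
        if j ∈ (M.neighbors i).filter (fun j => j < i) then φ (T' j) else q j := by
    intro p q φ s
    funext j
    split_ifs with ha hb
    · rfl
    · rw [h j (Finset.mem_filter.1 hb).2]
    · rfl
  simp only [integrateCell, CellData.mk.injEq]
  refine ⟨?_, ?_, ?_, ?_⟩
  · rw [h1 _ fun c => c.area i]
  · rw [h1 _ fun c => c.area i, h1 _ fun c => c.areaIntegral i]
  · exact h2 _ _ (fun c => c.area i) _
  · exact h2 _ _ (fun c => c.areaIntegral i) _

theorem foldl_integrateCell_of_notMem (M : Mesh d N) (f : Pt d → ℝ) (l : List (Fin N))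
    (T : Fin N → CellData N) {k : Fin N} (hk : k ∉ l) :
    l.foldl (fun T i => Function.update T i (integrateCell i M f T)) T k = T k := by
  induction l generalizing T with
  | nil => rfl
  | cons i l ih =>
    rw [List.mem_cons, not_or] at hk
    rw [List.foldl_cons, ih _ hk.2, Function.update_of_ne hk.1]

/-- The records satisfy the recursion by which they are defined. -/
theorem integrateAll_eq (M : Mesh d N) (f : Pt d → ℝ) (i : Fin N) :
    integrateAll M f i = integrateCell i M f (integrateAll M f) := by
  have key : ∀ (l : List (Fin N)) (T : Fin N → CellData N), l.Pairwise (· < ·) → i ∈ l →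
      l.foldl (fun T i => Function.update T i (integrateCell i M f T)) T i =
        integrateCell i M f
          (l.foldl (fun T i => Function.update T i (integrateCell i M f T)) T) := by
    intro l
    induction l with
    | nil => intro T _ hi; simp at hi
    | cons k l ih =>
      intro T hl hi
      rw [List.pairwise_cons] at hl
      rw [List.foldl_cons]
      by_cases hil : i ∈ l
      · exact ih _ hl.2 hil
      · obtain rfl : i = k := (List.mem_cons.1 hi).resolve_right hil
        rw [foldl_integrateCell_of_notMem M f l _ hil, Function.update_self]
        -- All cells still to come have indices above `i`, so the records read for `i` are already
        -- final.
        refine integrateCell_congr i M f fun j hj => ?_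
        rw [foldl_integrateCell_of_notMem M f l _ fun hjl => lt_asymm hj (hl.1 j hjl),
          Function.update_of_ne hj.ne]
  exact key _ _ (List.pairwise_lt_finRange N) (List.mem_finRange i)

theorem having_having_vertices (M : Mesh d N) (i j : Fin N) :
    having j (having i M.vertices) = M.faceVertices {i, j} := by
  rw [having_vertices, having_faceVertices, Finset.pair_comm]

theorem integrateAll_of_lt (hX : GeneralPosition M.nodes) (hM : M.IsComplete) (f : Pt d → ℝ)
    {i j : Fin N} (hij : i < j) (hb : Bornology.IsBounded (face M.nodes {i, j}))
    (hne : (face M.nodes {i, j}).Nonempty) :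
    (integrateAll M f i).area j =
        (pyramid M f i j).1 / d.factorial * (d / (‖M.nodes j - M.nodes i‖ / 2)) ∧
      (integrateAll M f i).areaIntegral j =
        (pyramid M f i j).2 / d.factorial * (d / (‖M.nodes j - M.nodes i‖ / 2)) := by
  have hj : j ∈ M.neighbors i :=
    (mem_neighbors hM).2 ⟨hij.ne', faceVertices_ne_nil hX hM ⟨i, by simp⟩ hb hne⟩
  rw [integrateAll_eq]
  simp only [integrateCell, Finset.mem_filter, hj, hij, and_self, if_true, having_having_vertices,
    affineSpan_faceVertices hX hM hb hne, infDist_perpBisector, Prod.smul_fst, Prod.smul_snd,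
    smul_eq_mul, pyramid]
  constructor <;> ring

theorem area_eq (hd : 2 ≤ d) (hX : GeneralPosition M.nodes) (hM : M.IsComplete)
    (f : Pt d → ℝ) {i j : Fin N} (hij : i ≠ j) (hb : Bornology.IsBounded (face M.nodes {i, j}))
    (hne : (face M.nodes {i, j}).Nonempty) :
    (integrateAll M f i).area j = (μHE[d - 1]).real (face M.nodes {i, j}) := by
  have key : ∀ i j : Fin N, i < j → Bornology.IsBounded (face M.nodes {i, j}) →
      (face M.nodes {i, j}).Nonempty →
      (integrateAll M f i).area j = (μHE[d - 1]).real (face M.nodes {i, j}) := by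
    intro i j hij hb hne
    have hpos : ‖M.nodes j - M.nodes i‖ ≠ 0 :=
      norm_ne_zero_iff.2 (sub_ne_zero.2 fun h => hij.ne (hX.1 h).symm)
    have h2 : (d : ℝ) ≠ 0 := by
      have : d ≠ 0 := by omega
      exact_mod_cast this
    rw [(integrateAll_of_lt hX hM f hij hb hne).1, area_pyramid hd hX hM f hij.ne hb]
    field_simp
  rcases lt_or_gt_of_ne hij with h | h
  · exact key i j h hb hne
  · rw [Finset.pair_comm] at hb hne ⊢
    rw [← key j i h hb hne, integrateAll_eq M f i]
    have hi : j ∈ M.neighbors i := by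
      refine (mem_neighbors hM).2 ⟨hij.symm, ?_⟩
      rw [Finset.pair_comm]
      exact faceVertices_ne_nil hX hM ⟨i, by simp⟩ hb hne
    simp [integrateCell, hi, h, h.not_gt]

theorem areaIntegral_eq (hd : 2 ≤ d) (hX : GeneralPosition M.nodes) (hM : M.IsComplete)
    {F f : Pt d → ℝ} {i j : Fin N} (hij : i ≠ j)
    (hb : Bornology.IsBounded (face M.nodes {i, j})) (hne : (face M.nodes {i, j}).Nonempty)
    (hF : ∀ L, IsFaceSimplex M {i, j} L → InterpolatesOn f F L) :
    (integrateAll M f i).areaIntegral j = ∫ y in face M.nodes {i, j}, F y ∂μHE[d - 1] := by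
  have key : ∀ i j : Fin N, i < j → Bornology.IsBounded (face M.nodes {i, j}) →
      (face M.nodes {i, j}).Nonempty → (∀ L, IsFaceSimplex M {i, j} L → InterpolatesOn f F L) →
      (integrateAll M f i).areaIntegral j = ∫ y in face M.nodes {i, j}, F y ∂μHE[d - 1] := by
    intro i j hij hb hne hF
    have hpos : ‖M.nodes j - M.nodes i‖ ≠ 0 :=
      norm_ne_zero_iff.2 (sub_ne_zero.2 fun h => hij.ne (hX.1 h).symm)
    have h2 : (d : ℝ) ≠ 0 := by
      have : d ≠ 0 := by omega
      exact_mod_cast this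
    rw [(integrateAll_of_lt hX hM f hij hb hne).2,
      (areaIntegral_pyramid hd hX hM hij.ne hb hF).2]
    field_simp
  rcases lt_or_gt_of_ne hij with h | h
  · exact key i j h hb hne hF
  · rw [Finset.pair_comm] at hb hne hF ⊢
    rw [← key j i h hb hne hF, integrateAll_eq M f i]
    have hi : j ∈ M.neighbors i := by
      refine (mem_neighbors hM).2 ⟨hij.symm, ?_⟩
      rw [Finset.pair_comm]
      exact faceVertices_ne_nil hX hM ⟨i, by simp⟩ hb hne
    simp [integrateCell, hi, h, h.not_gt]

theorem bounded_face_pair {i : Fin N} (hb : Bornology.IsBounded (cell x i)) (j : Fin N) :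
    Bornology.IsBounded (face x {i, j}) :=
  hb.subset fun _ hy => hy i (by simp)

theorem face_pair_nonempty (hM : M.IsComplete) {i j : Fin N} (hj : j ∈ M.neighbors i) :
    (face M.nodes {i, j}).Nonempty := by
  obtain ⟨v, hv⟩ := List.exists_mem_of_ne_nil _ ((mem_neighbors hM).1 hj).2
  have h := (mem_faceVertices hM).1 hv
  exact ⟨v.2, h.1.mem_face.2 h.2⟩

theorem sum_neighbors_split (M : Mesh d N) (i : Fin N) (p : Fin N → ℝ) :
    ∑ j ∈ M.neighbors i, p j = ∑ j ∈ (M.neighbors i).filter (fun j => i < j), p j +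
      ∑ j ∈ (M.neighbors i).filter (fun j => j < i), p j := by
  rw [← Finset.sum_filter_add_sum_filter_not (M.neighbors i) (fun j => i < j)]
  congr 1
  refine Finset.sum_congr (Finset.filter_congr fun j hj => ?_) fun _ _ => rfl
  have : j ≠ i := by
    simp only [Mesh.neighbors, Finset.mem_filter] at hj
    exact hj.2.1
  exact ⟨fun h => lt_of_le_of_ne (not_lt.1 h) this, fun h => h.not_gt⟩

/-- For `j < i` the copied area times `h_j / d` is the pyramid with apex `x_i`: by `area_pyramid`
the area is the same computed from either side. -/
theorem volume_eq_sum (hd : 2 ≤ d) (hX : GeneralPosition M.nodes) (hM : M.IsComplete)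
    (f : Pt d → ℝ) {i : Fin N} (hb : Bornology.IsBounded (cell M.nodes i)) :
    (integrateAll M f i).volume =
      ∑ j ∈ M.neighbors i, (pyramid M f i j).1 / d.factorial := by
  rw [integrateAll_eq, sum_neighbors_split]
  simp only [integrateCell, having_having_vertices, infDist_perpBisector, Prod.smul_fst,
    smul_eq_mul]
  congr 1
  · refine Finset.sum_congr rfl fun j _ => ?_
    rw [pyramid]; ring
  · refine Finset.sum_congr rfl fun j hj => ?_
    rw [Finset.mem_filter] at hj
    have hbj := bounded_face_pair hb j
    have hne := face_pair_nonempty hM hj.1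
    rw [area_pyramid hd hX hM f hj.2.ne' hbj]
    rw [Finset.pair_comm] at hbj hne ⊢
    rw [area_eq hd hX hM f hj.2.ne hbj hne]

/-- The interpolant serves as intermediary: the recursions started from `i` and from `j` both give
`h_j / d` times its integral over the common interface. -/
theorem integral_eq_sum (hd : 2 ≤ d) (hX : GeneralPosition M.nodes) (hM : M.IsComplete)
    {F f : Pt d → ℝ} (hF : IsLinearInterpolant M f F) {i : Fin N}
    (hb : Bornology.IsBounded (cell M.nodes i)) :
    (integrateAll M f i).integral =
      (d : ℝ) / (d + 1) * ∑ j ∈ M.neighbors i, (pyramid M f i j).2 / d.factorial +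
        1 / ((d : ℝ) + 1) * f (M.nodes i) *
          ∑ j ∈ M.neighbors i, (pyramid M f i j).1 / d.factorial := by
  rw [← volume_eq_sum hd hX hM f hb, integrateAll_eq, sum_neighbors_split]
  simp only [integrateCell, having_having_vertices, infDist_perpBisector, Prod.smul_snd,
    smul_eq_mul]
  congr 3
  · refine Finset.sum_congr rfl fun j _ => ?_
    rw [pyramid]; ring
  · refine Finset.sum_congr rfl fun j hj => ?_
    rw [Finset.mem_filter] at hj
    have hbj := bounded_face_pair hb j
    have hne := face_pair_nonempty hM hj.1
    have hFij := hF.interface i j hj.2.ne' (face_pair (x := M.nodes) i j ▸ hbj)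
    rw [(areaIntegral_pyramid hd hX hM hj.2.ne' hbj hFij).2]
    rw [Finset.pair_comm] at hbj hne hFij ⊢
    rw [areaIntegral_eq hd hX hM hj.2.ne hbj hne hFij]

theorem setIntegral_cell (hd : 2 ≤ d) (hX : GeneralPosition M.nodes) (hM : M.IsComplete)
    {i : Fin N} (hb : Bornology.IsBounded (cell M.nodes i)) {F : Pt d → ℝ}
    (hF : ∀ j ≠ i, IntegrableOn F (join (M.nodes i) (face M.nodes {i, j}))) :
    IntegrableOn F (cell M.nodes i) ∧ ∫ y in cell M.nodes i, F y =
      ∑ j ∈ M.neighbors i, ∫ y in join (M.nodes i) (face M.nodes {i, j}), F y := by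
  rw [← face_singleton] at hb ⊢
  have hη := Finset.singleton_nonempty i
  have hcard : ({i} : Finset (Fin N)).card ≤ d := by simp; omega
  have hm : nearest M.nodes (M.nodes i) = (({i} : Finset (Fin N)) : Set (Fin N)) := by
    rw [nearest_node hX.1]; simp
  have hint : IntegrableOn F (face M.nodes {i}) := by
    have := joins_face_eq_iUnion hX [] hη hcard hb hm
    rw [joins] at this
    rw [this]
    refine integrableOn_finite_iUnion.2 fun j => ?_
    have := hF j.1 (by simpa using j.2)
    rw [face_pair_eq_insert] at this
    exact this
  refine ⟨hint, ?_⟩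
  have h := setIntegral_joins_face hX (P := []) hη hcard hb hm (affineExtendable_nil _) hint
  rw [joins] at h
  rw [h]
  have hsub : M.neighbors i ⊆ ({i} : Finset (Fin N))ᶜ := fun j hj => by
    simpa using ((mem_neighbors hM).1 hj).1
  refine (Finset.sum_subset hsub fun j hj hjN => ?_).symm.trans
    (Finset.sum_congr rfl fun j _ => ?_)
  -- A nonempty bounded interface has a vertex, so every cell met by `C_i` is a recorded neighbour.
  · have he : face M.nodes (insert j {i}) = ∅ := by
      by_contra hne
      refine hjN ((mem_neighbors hM).2 ⟨by simpa using hj, ?_⟩)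
      rw [Finset.pair_comm]
      exact faceVertices_ne_nil hX hM (Finset.insert_nonempty _ _)
        (hb.subset (face_anti (Finset.subset_insert _ _))) (Set.nonempty_iff_ne_empty.2 hne)
    rw [he, joins_empty]; simp
  · rw [face_pair_eq_insert]; rfl

theorem volume_cell (hd : 2 ≤ d) (hX : GeneralPosition M.nodes) (hM : M.IsComplete)
    (f : Pt d → ℝ) {i : Fin N} (hb : Bornology.IsBounded (cell M.nodes i)) :
    volume.real (cell M.nodes i) = (integrateAll M f i).volume := by
  have h := (setIntegral_cell hd hX hM hb (F := fun _ => 1) fun j _ =>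
    continuous_const.continuousOn.integrableOn_compact
      (isCompact_join _ (isCompact_face (bounded_face_pair hb j)))).2
  simp only [setIntegral_const, smul_eq_mul, mul_one] at h
  rw [h, volume_eq_sum hd hX hM f hb]
  exact Finset.sum_congr rfl fun j hj => volume_pyramid hd hX hM f
    ((mem_neighbors hM).1 hj).1.symm (bounded_face_pair hb j)

theorem integral_cell (hd : 2 ≤ d) (hX : GeneralPosition M.nodes) (hM : M.IsComplete)
    {F f : Pt d → ℝ} (hF : IsLinearInterpolant M f F) {i : Fin N}
    (hb : Bornology.IsBounded (cell M.nodes i)) :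
    IntegrableOn F (cell M.nodes i) ∧
      ∫ y in cell M.nodes i, F y = (integrateAll M f i).integral := by
  have hpyr : ∀ j ≠ i, _ := fun j (hj : j ≠ i) =>
    setIntegral_pyramid hd hX hM (F := F) (f := f) hj.symm (f (M.nodes i))
      (bounded_face_pair hb j) fun L hL => by
        obtain ⟨a, haL, ha⟩ := hF.cell i j hj.symm hb L hL
        rw [convexHull_cons _ hL.ne_nil] at ha
        exact ⟨a, haL _ List.mem_cons_self, fun p hp => haL p (List.mem_cons_of_mem _ hp), ha⟩
  obtain ⟨h1, h2⟩ := setIntegral_cell hd hX hM hb fun j hj => (hpyr j hj).1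
  refine ⟨h1, h2.trans ?_⟩
  rw [integral_eq_sum hd hX hM hF hb,
    Finset.sum_congr rfl fun j hj => (hpyr j ((mem_neighbors hM).1 hj).1).2, Finset.mul_sum,
    Finset.mul_sum, ← Finset.sum_add_distrib]
  exact Finset.sum_congr rfl fun j _ => by ring

/-! ### Existence of the interpolant -/

/-- A function given on the faces with more than `k` generators extends to the faces with `k`
generators, affinely along the rays which start at prescribed interior points. -/
theorem exists_cone_extension (k : ℕ) (F : Pt d → ℝ) (m : Finset (Fin N) → Pt d)
    (φ : Finset (Fin N) → ℝ)
    (hm : ∀ η : Finset (Fin N), η.Nonempty → η.card = k → Bornology.IsBounded (face x η) →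
      (face x η).Nonempty → nearest x (m η) = η) :
    ∃ F' : Pt d → ℝ, (∀ y, k < (nearest x y).ncard → F' y = F y) ∧
      ∀ η : Finset (Fin N), η.Nonempty → η.card = k → Bornology.IsBounded (face x η) →
        ∀ j ∉ η, ∀ z ∈ face x (insert j η), ∀ t ∈ Set.Icc (0 : ℝ) 1,
          F' (AffineMap.lineMap (m η) z t) = (1 - t) * φ η + t * F z := by
  classical
  let R : Pt d → ℝ → Prop := fun y r => ∃ η : Finset (Fin N), η.Nonempty ∧ η.card = k ∧
    Bornology.IsBounded (face x η) ∧ nearest x y = η ∧ ∃ j ∉ η, ∃ z ∈ face x (insert j η),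
      ∃ t ∈ Set.Icc (0 : ℝ) 1, AffineMap.lineMap (m η) z t = y ∧ r = (1 - t) * φ η + t * F z
  -- The nearest nodes of `y` determine `η`. If `y` lies on cones over two facets, comparing both
  -- facet coordinates gives `t ≤ t'` and `t' ≤ t`; then `z = z'` unless `y` is the apex, where only
  -- `φ η` matters.
  have huniq : ∀ y r r', R y r → R y r' → r = r' := by
    rintro y r r' ⟨η, hη, hk, hb, hy, j, hj, z, hz, t, ht, rfl, rfl⟩
      ⟨η', _, _, _, hy', j', hj', z', hz', t', ht', hyz, rfl⟩
    obtain rfl : η = η' := Finset.coe_injective (hy.symm.trans hy')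
    have hsub : ∀ j, face x (insert j η) ⊆ face x η := fun j =>
      face_anti (Finset.subset_insert _ _)
    have hmη := hm η hη hk hb ⟨z, hsub j hz⟩
    obtain ⟨i, hi⟩ := hη
    have h1 := congrArg (facetCoord x i j (m η)) hyz
    have h2 := congrArg (facetCoord x i j' (m η)) hyz
    simp only [apply_lineMap, facetCoord_apex hmη hi hj, facetCoord_apex hmη hi hj',
      facetCoord_eq_zero hi hz, facetCoord_eq_zero hi hz'] at h1 h2
    have h3 := mul_nonneg ht'.1 (facetCoord_nonneg hmη hi j (hsub j' hz'))
    have h4 := mul_nonneg ht.1 (facetCoord_nonneg hmη hi j' (hsub j hz))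
    obtain rfl : t = t' := by linarith
    rcases eq_or_ne t 0 with rfl | ht0
    · simp
    · rw [lineMap_right_injective (m η) ht0 hyz]
  refine ⟨fun y => if h : ∃ r, R y r then h.choose else F y, fun y hy => ?_, ?_⟩
  · have : ¬ ∃ r, R y r := by
      rintro ⟨r, η, -, hk, -, hη, -⟩
      rw [hη, Set.ncard_coe_finset, hk] at hy
      exact lt_irrefl _ hy
    exact dif_neg this
  · intro η hη hk hb j hj z hz t ht
    have hsub : face x (insert j η) ⊆ face x η := face_anti (Finset.subset_insert _ _)
    have hmη := hm η hη hk hb ⟨z, hsub hz⟩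
    rcases lt_or_eq_of_le ht.2 with ht1 | rfl
    · have hR : R (AffineMap.lineMap (m η) z t) ((1 - t) * φ η + t * F z) :=
        ⟨η, hη, hk, hb, nearest_lineMap hη hmη (hsub hz) ht.1 ht1, j, hj, z, hz, t, ht, rfl, rfl⟩
      have hex : ∃ r, R (AffineMap.lineMap (m η) z t) r := ⟨_, hR⟩
      exact (dif_pos hex).trans (huniq _ _ _ hex.choose_spec hR)
    -- The end `t = 1` lies in a facet and has more than `k` nearest nodes, so the old value is kept
    -- there.
    · rw [AffineMap.lineMap_apply_one]
      have : ¬ ∃ r, R z r := by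
        rintro ⟨r, η', -, hk', -, hη', -⟩
        have h1 := mem_face_iff_subset_nearest.1 hz
        rw [hη', Finset.coe_subset] at h1
        have h2 := Finset.card_le_card h1
        rw [Finset.card_insert_of_notMem hj] at h2
        omega
      exact (dif_neg this).trans (by ring)

theorem InterpolatesOn.congr {f F F' : Pt d → ℝ} {L : List (Pt d)} (h : InterpolatesOn f F L)
    (hF : ∀ y ∈ convexHull ℝ {p | p ∈ L}, F' y = F y) : InterpolatesOn f F' L := by
  obtain ⟨a, h1, h2⟩ := h
  exact ⟨a, h1, fun y hy => (hF y hy).trans (h2 y hy)⟩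

/-- A multiple of the facet coordinate corrects the value at the apex without altering the affine
function on the facet. -/
theorem InterpolatesOn.cons {f F F' : Pt d → ℝ} {L : List (Pt d)} {η : Finset (Fin N)}
    {m : Pt d} {j : Fin N} (h : InterpolatesOn f F L) (hη : η.Nonempty) (hL : L ≠ [])
    (hLf : ∀ p ∈ L, p ∈ face x (insert j η)) (hm : nearest x m = η) (hj : j ∉ η)
    (hF : ∀ z ∈ face x (insert j η), ∀ t ∈ Set.Icc (0 : ℝ) 1,
      F' (AffineMap.lineMap m z t) = (1 - t) * f m + t * F z) :
    InterpolatesOn f F' (m :: L) := by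
  obtain ⟨a, haL, ha⟩ := h
  obtain ⟨i, hi⟩ := hη
  have hqm := facetCoord_apex hm hi hj
  have hconv : convexHull ℝ {p | p ∈ L} ⊆ face x (insert j η) := convexHull_min hLf (convex_face _)
  refine ⟨a + (f m - a m) • facetCoord x i j m, fun p hp => ?_, ?_⟩
  · rcases List.mem_cons.1 hp with rfl | hp
    · simp [hqm]
    · simp [facetCoord_eq_zero hi (hLf p hp), haL p hp]
  · rw [convexHull_cons m hL]
    rintro _ ⟨t, ht, z, hz, rfl⟩
    rw [hF z (hconv hz) t ht, ha z hz, apply_lineMap]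
    simp [hqm, facetCoord_eq_zero hi (hconv hz)]

theorem exists_affine_edge (hX : GeneralPosition M.nodes) (hM : M.IsComplete) (hd : 1 ≤ d)
    (f : Pt d → ℝ) {η : Finset (Fin N)} (hη : η.card = d)
    (hb : Bornology.IsBounded (face M.nodes η)) :
    ∃ a : Pt d →ᵃ[ℝ] ℝ, ∀ v ∈ M.faceVertices η, a v.2 = f v.2 := by
  rcases (face M.nodes η).eq_empty_or_nonempty with he | hne
  · exact ⟨AffineMap.const ℝ _ 0, by simp [faceVertices_eq_nil hM he]⟩
  obtain ⟨v, w, l, hV, hvw, -⟩ := exists_faceVertices_edge hX hM hd hη hb hne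
  have hv := (mem_faceVertices hM).1 (show v ∈ M.faceVertices η by simp [hV])
  have hw := (mem_faceVertices hM).1 (show w ∈ M.faceVertices η by simp [hV])
  have hne' : v.2 ≠ w.2 := fun h => by
    refine hvw (Prod.ext ?_ h)
    have := hv.1
    rw [h] at this
    exact (this.inj_left hw.1).symm
  set g : Pt d →ᵃ[ℝ] ℝ := (innerSL ℝ (w.2 - v.2)).toLinearMap.toAffineMap with hg
  have hgap : g w.2 - g v.2 ≠ 0 := by
    have : g w.2 - g v.2 = ‖w.2 - v.2‖ ^ 2 := by
      rw [← real_inner_self_eq_norm_sq, inner_sub_right]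
      rfl
    rw [this]
    exact pow_ne_zero 2 (norm_ne_zero_iff.2 (sub_ne_zero.2 hne'.symm))
  set s := (f w.2 - f v.2) / (g w.2 - g v.2) with hs
  refine ⟨s • g + AffineMap.const ℝ _ (f v.2 - s * g v.2), fun u hu => ?_⟩
  have hu' := (mem_faceVertices hM).1 hu
  have hval : ∀ y, (s • g + AffineMap.const ℝ (Pt d) (f v.2 - s * g v.2) : Pt d →ᵃ[ℝ] ℝ) y =
      f v.2 + s * (g y - g v.2) := fun y => by
    simp only [AffineMap.coe_add, AffineMap.coe_smul, Pi.add_apply, Pi.smul_apply,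
      AffineMap.const_apply, smul_eq_mul]
    ring
  rw [hval]
  rcases edge_vertex_eq hd hη hv.1 hw.1 hu'.1 hv.2 hw.2 hu'.2 hne' with h | h
  · rw [h]; ring
  · rw [h, hs]; field_simp; ring

/-- A further nearest node `k` would be nearest at both ends; both generator sets would then be
`insert k η`, and the ends would coincide. -/
theorem nearest_lineMap_edge {η σ τ : Finset (Fin N)} {v w : Pt d} (hd : 1 ≤ d)
    (hη : η.card = d) (hv : IsVertex x σ v) (hw : IsVertex x τ w) (hησ : η ⊆ σ) (hητ : η ⊆ τ)
    (hne : v ≠ w) {t : ℝ} (ht0 : 0 < t) (ht1 : t < 1) :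
    nearest x (AffineMap.lineMap v w t) = η := by
  obtain ⟨i, hi⟩ : η.Nonempty := Finset.card_pos.1 (by omega)
  have hiv := hv.mem_iff.1 (hησ hi)
  have hiw := hw.mem_iff.1 (hητ hi)
  have hyf : AffineMap.lineMap v w t ∈ face x η :=
    (convex_face η).segment_subset (hv.mem_face.2 hησ) (hw.mem_face.2 hητ)
      ((segment_eq_image_lineMap ℝ v w).symm ▸ ⟨t, ⟨ht0.le, ht1.le⟩, rfl⟩)
  refine Set.Subset.antisymm (fun k hk => ?_) (mem_face_iff_subset_nearest.1 hyf)
  by_contra hkη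
  have h0 := (mem_nearest_iff (hyf i hi)).1 hk
  have h1 := mem_cell_iff.1 (show v ∈ cell x i from hiv) k
  have h2 := mem_cell_iff.1 (show w ∈ cell x i from hiw) k
  rw [apply_lineMap] at h0
  have hkv : k ∈ σ := hv.mem_iff.2 ((mem_nearest_iff hiv).2 (by nlinarith))
  have hkw : k ∈ τ := hw.mem_iff.2 ((mem_nearest_iff hiw).2 (by nlinarith))
  have hins : ∀ ρ : Finset (Fin N), ρ.card = d + 1 → η ⊆ ρ → k ∈ ρ → insert k η = ρ :=
    fun ρ h1 h2 h3 => Finset.eq_of_subset_of_card_le (Finset.insert_subset h3 h2)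
      (by rw [Finset.card_insert_of_notMem hkη, hη, h1])
  have hστ : σ = τ := (hins σ hv.2.1 hησ hkv).symm.trans (hins τ hw.2.1 hητ hkw)
  subst hστ
  exact hne (hw.inj hv)

theorem exists_interpolates_edges (hX : GeneralPosition M.nodes) (hM : M.IsComplete)
    (hd : 1 ≤ d) (f : Pt d → ℝ) :
    ∃ F : Pt d → ℝ, ∀ η : Finset (Fin N), η.card = d → Bornology.IsBounded (face M.nodes η) →
      ∀ L, IsFaceSimplex M η L → InterpolatesOn f F L := by
  classical
  have hex : ∀ η : Finset (Fin N), ∃ a : Pt d →ᵃ[ℝ] ℝ, η.card = d →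
      Bornology.IsBounded (face M.nodes η) → ∀ v ∈ M.faceVertices η, a v.2 = f v.2 := by
    intro η
    by_cases h : η.card = d ∧ Bornology.IsBounded (face M.nodes η)
    · obtain ⟨a, ha⟩ := exists_affine_edge hX hM hd f h.1 h.2
      exact ⟨a, fun _ _ => ha⟩
    · exact ⟨AffineMap.const ℝ _ 0, fun h1 h2 => absurd ⟨h1, h2⟩ h⟩
  choose a ha using hex
  -- Points with exactly `d` nearest nodes take the affine function of the edge which these label;
  -- vertices have `d + 1` and keep `f`, so edges meeting at a vertex agree there.
  refine ⟨fun y => if (nearest M.nodes y).ncard = d then a (nearest M.nodes y).toFinset y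
    else f y, ?_⟩
  intro η hη hb L hL
  cases hL with
  | cone _ _ _ h => omega
  | edge _ v w _ hv hw hvw =>
    have hv' := (mem_faceVertices hM).1 hv
    have hw' := (mem_faceVertices hM).1 hw
    have hne : v.2 ≠ w.2 := fun h => by
      refine hvw (Prod.ext ?_ h)
      have := hv'.1
      rw [h] at this
      exact (this.inj_left hw'.1).symm
    have hvert : ∀ σ r, IsVertex M.nodes σ r → (nearest M.nodes r).ncard ≠ d := by
      intro σ r h
      rw [← h.1, Set.ncard_coe_finset, h.2.1]; omega
    refine ⟨a η, fun p hp => ?_, ?_⟩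
    · rcases List.mem_cons.1 hp with rfl | hp
      · exact ha η hη hb v hv
      · rw [List.mem_singleton.1 hp]; exact ha η hη hb w hw
    · rw [← segment_eq_convexHull_list, segment_eq_image_lineMap]
      rintro _ ⟨t, ht, rfl⟩
      rcases eq_or_lt_of_le ht.1 with rfl | ht0
      · rw [AffineMap.lineMap_apply_zero]
        exact (if_neg (hvert _ _ hv'.1)).trans (ha η hη hb v hv).symm
      rcases eq_or_lt_of_le ht.2 with rfl | ht1
      · rw [AffineMap.lineMap_apply_one]
        exact (if_neg (hvert _ _ hw'.1)).trans (ha η hη hb w hw).symm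
      have hnear := nearest_lineMap_edge hd hη hv'.1 hw'.1 hv'.2 hw'.2 hne ht0 ht1
      have hcard : (nearest M.nodes (AffineMap.lineMap v.2 w.2 t)).ncard = d := by
        rw [hnear, Set.ncard_coe_finset, hη]
      refine (if_pos hcard).trans ?_
      congr
      ext k
      simp [hnear]

/-- Descending induction on the least number `k` of generators. Each cone extension leaves the
points with more than `k` nearest nodes untouched, so earlier faces stay interpolated. -/
theorem exists_interpolates_faces (hX : GeneralPosition M.nodes) (hM : M.IsComplete)
    (f : Pt d → ℝ) (e k : ℕ) (hk : k + e = d) (hk1 : 1 ≤ k) :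
    ∃ F : Pt d → ℝ, ∀ η : Finset (Fin N), k ≤ η.card → η.card ≤ d →
      Bornology.IsBounded (face M.nodes η) →
      ∀ L, IsFaceSimplex M η L → InterpolatesOn f F L := by
  induction e generalizing k with
  | zero =>
    obtain ⟨F, hF⟩ := exists_interpolates_edges hX hM (by omega) f
    exact ⟨F, fun η h1 h2 => hF η (by omega)⟩
  | succ e ih =>
    obtain ⟨F, hF⟩ := ih (k + 1) (by omega) (by omega)
    obtain ⟨F', hF', hcone⟩ := exists_cone_extension (x := M.nodes) k F
      (fun η => midpoint (M.faceVertices η)) (fun η => f (midpoint (M.faceVertices η)))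
      fun η hη _ hb hne => nearest_midpoint hX hM hη hb hne
    refine ⟨F', fun η h1 h2 hb L hL => ?_⟩
    have hη : η.Nonempty := Finset.card_pos.1 (by omega)
    rcases eq_or_lt_of_le h1 with h1 | h1
    · cases hL with
      | edge _ v w h => omega
      | cone _ j L h hj hL =>
        have hb' := hb.subset (face_anti (x := M.nodes) (Finset.subset_insert j η))
        have hLf := hL.subset_face hX hM (Finset.insert_nonempty j η) hb'
        obtain ⟨p, hp⟩ := List.exists_mem_of_ne_nil _ hL.ne_nil
        have hcard := Finset.card_insert_of_notMem hj
        exact (hF _ (by omega) (by omega) hb' L hL).cons hη hL.ne_nil hLf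
          (nearest_midpoint hX hM hη hb ⟨p, face_anti (Finset.subset_insert _ _) (hLf p hp)⟩) hj
          (hcone η hη h1.symm hb j hj)
    · refine (hF η h1 h2 hb L hL).congr fun y hy => hF' y (h1.trans_le ?_)
      have := mem_face_iff_subset_nearest.1 (hL.convexHull_subset_face hX hM hη hb hy)
      rw [← Set.ncard_coe_finset]
      exact Set.ncard_le_ncard this (Set.toFinite _)

theorem exists_isLinearInterpolant (hd : 2 ≤ d) (hX : GeneralPosition M.nodes)
    (hM : M.IsComplete) (f : Pt d → ℝ) : ∃ F, IsLinearInterpolant M f F := by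
  obtain ⟨F, hF⟩ := exists_interpolates_faces hX hM f (d - 2) 2 (by omega) (by omega)
  have hF2 : ∀ i j : Fin N, i ≠ j → Bornology.IsBounded (face M.nodes {i, j}) →
      ∀ L, IsFaceSimplex M {i, j} L → InterpolatesOn f F L := fun i j hij =>
    hF {i, j} (Finset.card_pair hij).ge ((Finset.card_pair hij).trans_le hd)
  -- In the last extension, from interfaces to bounded cells, the apexes are the nodes instead of
  -- the midpoints.
  let m : Finset (Fin N) → Pt d := fun η => if h : η.Nonempty then M.nodes h.choose else 0
  have hm : ∀ i, m {i} = M.nodes i := fun i => by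
    have h := Finset.singleton_nonempty i
    exact (dif_pos h).trans (by rw [Finset.mem_singleton.1 h.choose_spec])
  have hnear : ∀ i, nearest M.nodes (M.nodes i) = (({i} : Finset (Fin N)) : Set (Fin N)) :=
    fun i => by rw [nearest_node hX.1]; simp
  obtain ⟨F', hF', hcone⟩ := exists_cone_extension (x := M.nodes) 1 F m (fun η => f (m η)) (by
    intro η _ hη _ _
    obtain ⟨i, rfl⟩ := Finset.card_eq_one.1 hη
    rw [hm, hnear])
  refine ⟨F', fun i j hij hb L hL => ?_, fun i j hij hb L hL => ?_⟩
  · rw [← face_pair] at hb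
    refine (hF2 i j hij hb L hL).congr fun y hy => hF' y ?_
    have hy' := mem_face_iff_subset_nearest.1
      (hL.convexHull_subset_face hX hM ⟨i, by simp⟩ hb hy)
    have := Set.ncard_le_ncard hy' (Set.toFinite _)
    rw [Set.ncard_coe_finset, Finset.card_pair hij] at this
    omega
  · have hb' := bounded_face_pair hb j
    have hLf := hL.subset_face hX hM ⟨i, by simp⟩ hb'
    rw [face_pair_eq_insert] at hLf
    refine (hF2 i j hij hb' L hL).cons (Finset.singleton_nonempty i) hL.ne_nil hLf
      (hnear i) (by simpa using hij.symm) ?_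
    have := hcone {i} (Finset.singleton_nonempty i) (Finset.card_singleton i)
      (by rw [face_singleton]; exact hb) j (by simpa using hij.symm)
    rwa [hm] at this

end VoronoiIntegration

end

/-- The finiteness and integrability clauses ensure that `.real` and the integrals are genuine
values and not defaults. -/
theorem mainTheorem1 {d N : ℕ} (hd : 2 ≤ d)
    (M : VoronoiIntegration.Mesh d N)
    (hX : VoronoiIntegration.GeneralPosition M.nodes)
    (hM : M.IsComplete)
    (f : EuclideanSpace ℝ (Fin d) → ℝ) :
    (∀ i : Fin N, Bornology.IsBounded (VoronoiIntegration.cell M.nodes i) →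
      volume (VoronoiIntegration.cell M.nodes i) ≠ ⊤ ∧
      volume.real (VoronoiIntegration.cell M.nodes i) =
        (VoronoiIntegration.integrateAll M f i).volume) ∧
    (∀ i j : Fin N, i ≠ j →
      (VoronoiIntegration.cell M.nodes i ∩ VoronoiIntegration.cell M.nodes j).Nonempty →
      Bornology.IsBounded
        (VoronoiIntegration.cell M.nodes i ∩ VoronoiIntegration.cell M.nodes j) →
      μHE[d - 1] (VoronoiIntegration.cell M.nodes i ∩ VoronoiIntegration.cell M.nodes j) ≠ ⊤ ∧
      (μHE[d - 1]).real
          (VoronoiIntegration.cell M.nodes i ∩ VoronoiIntegration.cell M.nodes j) =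
        (VoronoiIntegration.integrateAll M f i).area j) ∧
    (∃ F, VoronoiIntegration.IsLinearInterpolant M f F) ∧
    (∀ F, VoronoiIntegration.IsLinearInterpolant M f F →
      (∀ i : Fin N, Bornology.IsBounded (VoronoiIntegration.cell M.nodes i) →
        IntegrableOn F (VoronoiIntegration.cell M.nodes i) ∧
        ∫ y in VoronoiIntegration.cell M.nodes i, F y =
          (VoronoiIntegration.integrateAll M f i).integral) ∧
      (∀ i j : Fin N, i ≠ j →
        (VoronoiIntegration.cell M.nodes i ∩ VoronoiIntegration.cell M.nodes j).Nonempty →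
        Bornology.IsBounded
          (VoronoiIntegration.cell M.nodes i ∩ VoronoiIntegration.cell M.nodes j) →
        IntegrableOn F
          (VoronoiIntegration.cell M.nodes i ∩ VoronoiIntegration.cell M.nodes j) μHE[d - 1] ∧
        ∫ y in VoronoiIntegration.cell M.nodes i ∩ VoronoiIntegration.cell M.nodes j,
            F y ∂μHE[d - 1] =
          (VoronoiIntegration.integrateAll M f i).areaIntegral j)) := by
  open VoronoiIntegration in
  refine ⟨fun i hb => ⟨(Metric.isCompact_of_isClosed_isBounded (isClosed_cell i)
      hb).measure_lt_top.ne, volume_cell hd hX hM f hb⟩, fun i j hij hne hb => ?_,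
    exists_isLinearInterpolant hd hX hM f, fun F hF =>
      ⟨fun i hb => integral_cell hd hX hM hF hb, fun i j hij hne hb => ?_⟩⟩
  · rw [← face_pair] at hne hb ⊢
    exact ⟨hausdorff_face_pair_ne_top hX hij hb, (area_eq hd hX hM f hij hb hne).symm⟩
  · have hFij := hF.interface i j hij hb
    rw [← face_pair] at hne hb ⊢
    exact ⟨(areaIntegral_pyramid hd hX hM hij hb hFij).1,
      (areaIntegral_eq hd hX hM hij hb hne hFij).symm⟩
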